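/- Let $m\ge 1$, $n\ge 0$ and $2\le k\le\infty$. For an embedded closed (compact, without boundary, not necessarily connected) oriented $m$-dimensional submanifold $M\subset\mathbb{R}^n$ of class $C^k$ and distinct $x,y\in M$, let $\Sigma_x(y)$ be the unique $m$-sphere (an affine $m$-plane if $y-x\in T_xM$) that is tangent to $M$ at $x$ and passes through $y$, oriented so that its orientation agrees with that of $M$ at $x$. Define the combined angle $\theta_M(x,y)$ by $$\cos\theta_M(x,y)=\det\big(\langle u_i,v_j\rangle\big)_{1\le i,j\le m},$$ where $u_1,\dots,u_m$ and $v_1,\dots,v_m$ are positively oriented orthonormal bases of $T_y\Sigma_x(y)$ and $T_yM$, respectively. The Kusner--Sullivan energy of $M$ is $$E_{KS}(M)=\iint_{M\times M}\frac{(1-\cos\theta_M(x,y))^m}{|x-y|^{2m}}\,dx\,dy\in[0,\infty],$$ where $dx$ and $dy$ denote the $m$-dimensional volume on $M$. Equip the set $C^k(N,\mathbb{R}^n)$ of $C^k$ maps from a closed oriented $m$-dimensional $C^k$-manifold $N$ to $\mathbb{R}^n$ with the compact-open $C^2$-topology (uniform convergence, on compact subsets of charts, of all partial derivatives of order at most $2$),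 and the set $\mathrm{Emb}^k(N,\mathbb{R}^n)$ of $C^k$ embeddings with the subspace topology. The space of embedded closed oriented $m$-dimensional submanifolds of $\mathbb{R}^n$ of class $C^k$, with its $C^2$-topology, is the disjoint union $$\bigsqcup_{N}\ \mathrm{Emb}^k(N,\mathbb{R}^n)/\mathrm{Diff}^k_+(N)$$ over the oriented $C^k$-diffeomorphism types of such $N$, where the group $\mathrm{Diff}^k_+(N)$ of orientation preserving $C^k$-diffeomorphisms acts by composition, and each quotient carries the quotient topology. Then $E_{KS}$ is finite on this space, and it is continuous with respect to the $C^2$-topology. -/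

import Mathlib

open Set MeasureTheory
open scoped Topology Manifold ContDiff ENNReal InnerProductSpace

noncomputable section

namespace KusnerSullivan

abbrev Euc (d : ℕ) : Type := EuclideanSpace ℝ (Fin d)

/-! ### Closed oriented manifolds -/

/-- A closed (compact, Hausdorff, boundaryless, not necessarily connected) `m`-dimensional manifold
of class `C^k`, oriented by means of an oriented atlas: all the changes of charts have positive
Jacobian determinant. -/
structure ClosedOrientedManifold (m : ℕ) (k : ℕ∞) : Type 1 where
  carrier : Type
  [top : TopologicalSpace carrier]
  [charted : ChartedSpace (Euc m) carrier]
  [isManifold : IsManifold 𝓘(ℝ, Euc m) k carrier]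
  [compact : CompactSpace carrier]
  [t2 : T2Space carrier]
  oriented : ∀ φ ∈ atlas (Euc m) carrier, ∀ φ' ∈ atlas (Euc m) carrier,
    ∀ p ∈ φ.source ∩ φ'.source, 0 < (fderiv ℝ (φ' ∘ φ.symm) (φ p)).det

instance (m : ℕ) (k : ℕ∞) : CoeSort (ClosedOrientedManifold m k) Type :=
  ⟨ClosedOrientedManifold.carrier⟩

attribute [instance] ClosedOrientedManifold.top ClosedOrientedManifold.charted
  ClosedOrientedManifold.isManifold ClosedOrientedManifold.compact ClosedOrientedManifold.t2

variable {m n : ℕ} {k : ℕ∞}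

/-- A diffeomorphism is orientation preserving if its Jacobian determinants in the charts of the
two oriented atlases are positive. -/
def IsOrientationPreserving {M N : ClosedOrientedManifold m k}
    (Φ : M ≃ₘ^k⟮𝓘(ℝ, Euc m), 𝓘(ℝ, Euc m)⟯ N) : Prop :=
  ∀ φ ∈ atlas (Euc m) M, ∀ ψ ∈ atlas (Euc m) N, ∀ p ∈ φ.source, Φ p ∈ ψ.source →
    0 < (fderiv ℝ (ψ ∘ Φ ∘ φ.symm) (φ p)).det

/-! ### The compact-open `C^q` topology -/

section CompactOpen

variable {M : Type} [TopologicalSpace M] [ChartedSpace (Euc m) M]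
  {N : Type} [TopologicalSpace N] [ChartedSpace (Euc n) N]

/-- The set of `g` in `C^k(M, N)` that map `K` into the domain of the chart `ψ`, and whose partial
derivatives of order at most `q`, read in the charts `φ` and `ψ`, differ from those of `f` by less
than `ε` on `φ(K)`. The tuple `μ` lists the directions of differentiation. -/
def subbasicSet (q : ℕ) (f : C^k⟮𝓘(ℝ, Euc m), M; 𝓘(ℝ, Euc n), N⟯)
    (φ : OpenPartialHomeomorph M (Euc m)) (ψ : OpenPartialHomeomorph N (Euc n))
    (K : Set M) (ε : ℝ) : Set C^k⟮𝓘(ℝ, Euc m), M; 𝓘(ℝ, Euc n), N⟯ :=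
  {g | MapsTo g K ψ.source ∧ ∀ x ∈ φ '' K, ∀ j ≤ q, ∀ μ : Fin j → Fin m,
    ‖iteratedFDeriv ℝ j (ψ ∘ g ∘ φ.symm) x (fun i => EuclideanSpace.single (μ i) 1)
      - iteratedFDeriv ℝ j (ψ ∘ f ∘ φ.symm) x (fun i => EuclideanSpace.single (μ i) 1)‖ < ε}

/-- The compact-open `C^q` topology (weak topology) on `C^k(M, N)`. -/
@[reducible] def compactOpenTopology (q : ℕ) : TopologicalSpace C^k⟮𝓘(ℝ, Euc m), M; 𝓘(ℝ, Euc n), N⟯ :=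
  TopologicalSpace.generateFrom
    {S | ∃ (f : C^k⟮𝓘(ℝ, Euc m), M; 𝓘(ℝ, Euc n), N⟯)
      (φ : OpenPartialHomeomorph M (Euc m)) (ψ : OpenPartialHomeomorph N (Euc n))
      (K : Set M) (ε : ℝ),
      φ ∈ IsManifold.maximalAtlas 𝓘(ℝ, Euc m) k M ∧
      ψ ∈ IsManifold.maximalAtlas 𝓘(ℝ, Euc n) k N ∧
      IsCompact K ∧ K ⊆ φ.source ∧ MapsTo f K ψ.source ∧ 0 < ε ∧
      S = subbasicSet q f φ ψ K ε}

end CompactOpen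

/-! ### Embeddings and the space of embedded submanifolds -/

/-- `C^k` embeddings of `M` into `ℝⁿ`. -/
structure Emb (M : ClosedOrientedManifold m k) (n : ℕ) : Type where
  toMap : C^k⟮𝓘(ℝ, Euc m), M; 𝓘(ℝ, Euc n), Euc n⟯
  immersion : ∀ p : M, Function.Injective (mfderiv 𝓘(ℝ, Euc m) 𝓘(ℝ, Euc n) toMap p)
  isEmbedding : Topology.IsEmbedding toMap

/-- The compact-open `C^q` topology on `C^k` embeddings. -/
@[reducible] def embTopology (q : ℕ) (M : ClosedOrientedManifold m k) (n : ℕ) : TopologicalSpace (Emb M n) :=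
  TopologicalSpace.induced Emb.toMap (compactOpenTopology q)

/-- Two embeddings define the same oriented submanifold if they differ by an orientation preserving
diffeomorphism of their domains. This is an equivalence relation. -/
def SameSubmanifold (a b : Σ M : ClosedOrientedManifold m k, Emb M n) : Prop :=
  ∃ Φ : a.1 ≃ₘ^k⟮𝓘(ℝ, Euc m), 𝓘(ℝ, Euc m)⟯ b.1,
    IsOrientationPreserving Φ ∧ ∀ p, a.2.toMap p = b.2.toMap (Φ p)

/-- The set of embedded closed oriented `m`-dimensional submanifolds of `ℝⁿ` of class `C^k`: the
disjoint union, over the diffeomorphism types of `M`, of the embeddings of `M` modulo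
diffeomorphisms. -/
def EmbeddedSubmanifold (m n : ℕ) (k : ℕ∞) : Type 1 :=
  Quot (SameSubmanifold (m := m) (n := n) (k := k))

/-- The `C^q` topology on the space of embedded submanifolds: the quotient of the disjoint union of
the compact-open `C^q` topologies. -/
@[reducible] def submanifoldTopology (m n : ℕ) (k : ℕ∞) (q : ℕ) :
    TopologicalSpace (EmbeddedSubmanifold m n k) :=
  TopologicalSpace.coinduced (Quot.mk _)
    (@instTopologicalSpaceSigma (ClosedOrientedManifold m k) (fun M => Emb M n)
      (fun M => embTopology q M n))

/-! ### The combined angle -/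

/-- `b'` is obtained from `b` by a matrix of positive determinant. For bases of the same vector
space this means that they define the same orientation. -/
def SameOrientation {d : ℕ} (b b' : Fin d → Euc n) : Prop :=
  ∃ A : Matrix (Fin d) (Fin d) ℝ, 0 < A.det ∧ ∀ i, b' i = ∑ j, A i j • b j

/-- The positively oriented bases of the tangent space `T_x f(M)`. -/
def positiveFrames {M : ClosedOrientedManifold m k} (f : M → Euc n) (x : Euc n) :
    Set (Fin m → Euc n) :=
  {e | ∃ φ ∈ atlas (Euc m) M, ∃ p ∈ φ.source, f p = x ∧
    SameOrientation
      (fun i => fderiv ℝ (f ∘ φ.symm) (φ p) (EuclideanSpace.single i 1)) e}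

/-- Let `e` be an oriented basis of an `m`-plane `P`, and let `Σ` be the oriented `m`-sphere through
`y` that is tangent to `P` at `x` and has the orientation of `e` there. The predicate says that `u`
is a positively oriented basis of `T_y Σ`.

If `y - x` is in `P`, then `Σ` is the oriented plane `x + P`. Otherwise `Σ` is the round sphere with
some centre `c` in the affine `(m+1)`-space spanned by `x + P` and `y`; with `W` the direction of
that space, the tangent space of `Σ` at a point `z` is the orthogonal complement of `z - c` in `W`,
and a basis `w` of it is positive if `(z - c, w)` is a positive basis of `W`, where `W` is oriented
in such a way that `e` is positive at `x`. -/
def IsSphereFrame (x y : Euc n) (e u : Fin m → Euc n) : Prop :=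
  (y - x ∈ Submodule.span ℝ (range e) ∧ SameOrientation e u) ∨
  ∃ c : Euc n, c ≠ x ∧ (∀ i, ⟪e i, x - c⟫_ℝ = 0) ∧ dist y c = dist x c ∧
    y - c ∈ Submodule.span ℝ (insert (x - c) (range e)) ∧ (∀ i, ⟪u i, y - c⟫_ℝ = 0) ∧
    SameOrientation (Fin.cons (x - c) e : Fin (m + 1) → Euc n) (Fin.cons (y - c) u)

/-- `r` is the cosine of the combined angle of an oriented submanifold at `x` and `y`, where `T x`
is the set of the positively oriented bases of its tangent space at `x`: `r = det ⟨uᵢ, vⱼ⟩` for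
positively oriented orthonormal bases `u` of `T_y Σ_x(y)` and `v` of the tangent space at `y`. -/
def IsCosCombinedAngle (T : Euc n → Set (Fin m → Euc n)) (x y : Euc n) (r : ℝ) : Prop :=
  ∃ e ∈ T x, ∃ u, IsSphereFrame x y e u ∧ Orthonormal ℝ u ∧
    ∃ v ∈ T y, Orthonormal ℝ v ∧ r = (Matrix.of fun i j => ⟪u i, v j⟫_ℝ).det

/-- The cosine of the combined angle, that is, the number `r` with `IsCosCombinedAngle T x y r`. -/
def cosCombinedAngle (T : Euc n → Set (Fin m → Euc n)) (x y : Euc n) : ℝ :=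
  Classical.epsilon (IsCosCombinedAngle T x y)

/-! ### The energy -/

/-- The Kusner–Sullivan energy of the image of `f`; `μHE[m]` is the `m`-dimensional volume, i.e. the
Hausdorff measure normalized to agree with Lebesgue measure on `ℝᵐ`. -/
def energyOfMap {M : ClosedOrientedManifold m k} (f : M → Euc n) : ℝ≥0∞ :=
  ∫⁻ x in range f, ∫⁻ y in range f,
    ENNReal.ofReal ((1 - cosCombinedAngle (positiveFrames f) x y) ^ m / dist x y ^ (2 * m))
      ∂μHE[m] ∂μHE[m]

theorem SameOrientation.symm {d : ℕ} {b b' : Fin d → Euc n} (h : SameOrientation b b') :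
    SameOrientation b' b := by
  obtain ⟨A, hA, h⟩ := h
  refine ⟨A⁻¹, ?_, fun i => ?_⟩
  · rw [Matrix.det_nonsing_inv, Ring.inverse_eq_inv']
    exact inv_pos.mpr hA
  · have hu : IsUnit A.det := hA.ne'.isUnit
    simp_rw [h, Finset.smul_sum, smul_smul]
    rw [Finset.sum_comm]
    simp_rw [← Finset.sum_smul, ← Matrix.mul_apply, Matrix.nonsing_inv_mul A hu, Matrix.one_apply]
    simp

theorem SameOrientation.trans {d : ℕ} {b b' b'' : Fin d → Euc n} (h : SameOrientation b b')
    (h' : SameOrientation b' b'') : SameOrientation b b'' := by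
  obtain ⟨A, hA, h⟩ := h
  obtain ⟨B, hB, h'⟩ := h'
  refine ⟨B * A, by rw [Matrix.det_mul]; exact mul_pos hB hA, fun i => ?_⟩
  simp_rw [h', h, Finset.smul_sum, smul_smul]
  rw [Finset.sum_comm]
  simp_rw [← Finset.sum_smul, ← Matrix.mul_apply]

theorem sameOrientation_coordinateFrame {M N : ClosedOrientedManifold m k} (hk : 1 ≤ k)
    {f : M → Euc n} {g : C^k⟮𝓘(ℝ, Euc m), N; 𝓘(ℝ, Euc n), Euc n⟯}
    {Φ : M ≃ₘ^k⟮𝓘(ℝ, Euc m), 𝓘(ℝ, Euc m)⟯ N} (hΦ : IsOrientationPreserving Φ)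
    (hf : ∀ p, f p = g (Φ p)) {φ : OpenPartialHomeomorph M (Euc m)} (hφ : φ ∈ atlas (Euc m) M)
    {ψ : OpenPartialHomeomorph N (Euc m)} (hψ : ψ ∈ atlas (Euc m) N) {p : M} (hp : p ∈ φ.source)
    (hq : Φ p ∈ ψ.source) :
    SameOrientation
      (fun i => fderiv ℝ (g ∘ ψ.symm) (ψ (Φ p)) (EuclideanSpace.single i 1))
      (fun i => fderiv ℝ (f ∘ φ.symm) (φ p) (EuclideanSpace.single i 1)) := by
  have hk' : (k : WithTop ℕ∞) ≠ 0 := by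
    have : k ≠ 0 := (zero_lt_one.trans_le hk).ne'
    exact_mod_cast this
  have hk1 : (1 : WithTop ℕ∞) ≤ k := by exact_mod_cast hk
  have : IsManifold 𝓘(ℝ, Euc m) 1 M := IsManifold.of_le hk1
  have : IsManifold 𝓘(ℝ, Euc m) 1 N := IsManifold.of_le hk1
  have hpt : φ p ∈ φ.target := φ.map_source hp
  have hqt : ψ (Φ p) ∈ ψ.target := ψ.map_source hq
  have hsp : φ.symm (φ p) = p := φ.left_inv hp
  have hsq : ψ.symm (ψ (Φ p)) = Φ p := ψ.left_inv hq
  have dφ : MDifferentiableAt 𝓘(ℝ, Euc m) 𝓘(ℝ, Euc m) φ.symm (φ p) :=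
    mdifferentiableAt_atlas_symm hφ hpt
  have dψs : MDifferentiableAt 𝓘(ℝ, Euc m) 𝓘(ℝ, Euc m) ψ.symm (ψ (Φ p)) :=
    mdifferentiableAt_atlas_symm hψ hqt
  have dψ : MDifferentiableAt 𝓘(ℝ, Euc m) 𝓘(ℝ, Euc m) ψ (Φ p) :=
    mdifferentiableAt_atlas hψ hq
  have dΦ : MDifferentiableAt 𝓘(ℝ, Euc m) 𝓘(ℝ, Euc m) Φ p := Φ.mdifferentiable hk' p
  have dg : MDifferentiableAt 𝓘(ℝ, Euc m) 𝓘(ℝ, Euc n) g (Φ p) :=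
    g.contMDiff.mdifferentiable hk' _
  have d1 : DifferentiableAt ℝ (ψ ∘ Φ ∘ φ.symm) (φ p) := by
    rw [← mdifferentiableAt_iff_differentiableAt]
    refine MDifferentiableAt.comp (I' := 𝓘(ℝ, Euc m)) _ ?_
      (MDifferentiableAt.comp (I' := 𝓘(ℝ, Euc m)) _ ?_ dφ)
    · simpa [hsp] using dψ
    · simpa [hsp] using dΦ
  have d2 : DifferentiableAt ℝ (g ∘ ψ.symm) (ψ (Φ p)) := by
    rw [← mdifferentiableAt_iff_differentiableAt]
    refine MDifferentiableAt.comp (I' := 𝓘(ℝ, Euc m)) _ ?_ dψs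
    simpa [hsq] using dg
  have hval : (ψ ∘ Φ ∘ φ.symm) (φ p) = ψ (Φ p) := by simp [hsp]
  have hev : f ∘ φ.symm =ᶠ[nhds (φ p)] (g ∘ ψ.symm) ∘ (ψ ∘ Φ ∘ φ.symm) := by
    have hc : ContinuousAt (Φ ∘ φ.symm) (φ p) :=
      Φ.continuous.continuousAt.comp (φ.continuousAt_symm hpt)
    have hm : ψ.source ∈ nhds ((Φ ∘ φ.symm) (φ p)) := by
      simpa [hsp] using ψ.open_source.mem_nhds hq
    filter_upwards [hc hm] with z hz
    have hz' : Φ (φ.symm z) ∈ ψ.source := hz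
    simp [hf, ψ.left_inv hz']
  have hchain : fderiv ℝ (f ∘ φ.symm) (φ p) =
      (fderiv ℝ (g ∘ ψ.symm) (ψ (Φ p))).comp (fderiv ℝ (ψ ∘ Φ ∘ φ.symm) (φ p)) := by
    rw [hev.fderiv_eq, fderiv_comp _ (by rwa [hval]) d1, hval]
  set J := fderiv ℝ (ψ ∘ Φ ∘ φ.symm) (φ p) with hJ
  have hdet : 0 < J.det := hΦ φ hφ ψ hψ p hp hq
  let B := (EuclideanSpace.basisFun (Fin m) ℝ).toBasis
  refine ⟨(LinearMap.toMatrix B B (J : Euc m →ₗ[ℝ] Euc m)).transpose, ?_, fun i => ?_⟩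
  · rw [Matrix.det_transpose, LinearMap.det_toMatrix]
    exact hdet
  · have hexp : J (EuclideanSpace.single i 1) =
        ∑ j, (J (EuclideanSpace.single i 1)) j • (EuclideanSpace.single j (1 : ℝ) : Euc m) := by
      simpa using ((EuclideanSpace.basisFun (Fin m) ℝ).sum_repr (J (EuclideanSpace.single i 1))).symm
    simp only [hchain, ContinuousLinearMap.comp_apply]
    conv_lhs => rw [hexp]
    simp [B, LinearMap.toMatrix_apply, map_sum, map_smul]

theorem positiveFrames_comp {M N : ClosedOrientedManifold m k} (hk : 1 ≤ k)
    {f : M → Euc n} {g : C^k⟮𝓘(ℝ, Euc m), N; 𝓘(ℝ, Euc n), Euc n⟯}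
    {Φ : M ≃ₘ^k⟮𝓘(ℝ, Euc m), 𝓘(ℝ, Euc m)⟯ N} (hΦ : IsOrientationPreserving Φ)
    (hf : ∀ p, f p = g (Φ p)) : positiveFrames f = positiveFrames (g : N → Euc n) := by
  ext x e
  constructor
  · rintro ⟨φ, hφ, p, hp, hx, h⟩
    have hq := mem_chart_source (Euc m) (Φ p)
    have hψ := chart_mem_atlas (Euc m) (Φ p)
    exact ⟨_, hψ, Φ p, hq, by rw [← hf, hx],
      (sameOrientation_coordinateFrame hk hΦ hf hφ hψ hp hq).trans h⟩
  · rintro ⟨ψ, hψ, q, hq, hx, h⟩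
    obtain ⟨p, rfl⟩ : ∃ p, Φ p = q := Φ.surjective q
    have hp := mem_chart_source (Euc m) p
    have hφ := chart_mem_atlas (Euc m) p
    exact ⟨_, hφ, p, hp, by rw [hf, hx],
      (sameOrientation_coordinateFrame hk hΦ hf hφ hψ hp hq).symm.trans h⟩

/-- The energy depends only on the oriented submanifold. -/
theorem energyOfMap_eq (hk : 2 ≤ k) (a b : Σ M : ClosedOrientedManifold m k, Emb M n)
    (h : SameSubmanifold a b) : energyOfMap a.2.toMap = energyOfMap b.2.toMap := by
  obtain ⟨Φ, hΦ, hf⟩ := h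
  have h1 : positiveFrames (a.2.toMap : a.1 → Euc n) = positiveFrames (b.2.toMap : b.1 → Euc n) :=
    positiveFrames_comp (one_le_two.trans hk) hΦ hf
  have h2 : range (a.2.toMap : a.1 → Euc n) = range (b.2.toMap : b.1 → Euc n) := by
    have : (a.2.toMap : a.1 → Euc n) = (b.2.toMap : b.1 → Euc n) ∘ Φ := funext hf
    have hs : Function.Surjective Φ := Φ.surjective
    rw [this, hs.range_comp]
  simp only [energyOfMap, h1, h2]

/-- The Kusner–Sullivan energy
`E_KS(M) = ∫_M ∫_M (1 - cos θ_M(x, y))^m / |x - y|^(2m) dy dx` on the set of embedded closed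
oriented `m`-dimensional submanifolds of `ℝⁿ` of class `C^k`, `k ≥ 2`. -/
def energyKS (hk : 2 ≤ k) : EmbeddedSubmanifold m n k → ℝ≥0∞ :=
  Quot.lift (fun a => energyOfMap a.2.toMap) (energyOfMap_eq hk)

end KusnerSullivan

end

noncomputable section

namespace KusnerSullivan

variable {m n : ℕ} {k : ℕ∞}

open Filter Asymptotics
open scoped NNReal

/-! Let `R` be the reflection in the hyperplane orthogonal to `y - x`. It carries the tangent space
of the sphere at `x` to that at `y` and reverses orientation, and the same holds when the sphere
degenerates to a plane. Hence, for arbitrary positive frames `a`, `b` of the tangent spaces at `x`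
and `y`, the cosine of the combined angle is `-det ⟨R aᵢ, bⱼ⟩ / √(det ⟨aᵢ, aⱼ⟩ det ⟨bᵢ, bⱼ⟩)`. This
is `angleCos`; the sphere has disappeared, and the expression is continuous in the 1-jets as long as
`x ≠ y` (`tendsto_angleCos`).

Near the diagonal, the frames at `x` and `y` in a common chart differ by `O(|x - y|)`, and so does
the unit vector along `y - x` from the tangent space at `x`. By a Schur complement identity the
deviation of `cos²` from `1` is quadratic in these errors. Since the cosine tends to `1`, it follows
that `1 - cos = O(|x - y|²)` (`one_sub_angleCos_isBigO`), and the integrand of the energy is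
bounded. The constants depend only on first derivatives and a Lipschitz bound for them, so the bound
is uniform for embeddings `C²`-close to a given one (`LocallyC2Tendsto.exists_integrand_le`).

Everything is integrated over the fixed parameter manifold. With the volume of the limit embedding
`f₀` kept fixed, the energies converge by dominated convergence
(`LocallyC2Tendsto.tendsto_energyWith`). Close embeddings are related by bi-Lipschitz maps with
constants near `1`, so their Hausdorff measures are comparable up to a factor `K ^ m` with `K` near
`1`; exchanging the measure then costs at most `K ^ (2m)` (`LocallyC2Tendsto.tendsto_energyOfMap`).
Finiteness follows from the bounded integrand and the finite volume. -/

/-! ### Change of frames -/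

/-- The frame obtained from `a` by the matrix `A`. -/
def changeFrame {d d' : ℕ} (A : Matrix (Fin d) (Fin d') ℝ) (a : Fin d' → Euc n) : Fin d → Euc n :=
  fun i => ∑ j, A i j • a j

/-- The matrix of the inner products of two frames. -/
def crossGram {d d' : ℕ} (a : Fin d → Euc n) (b : Fin d' → Euc n) : Matrix (Fin d) (Fin d') ℝ :=
  Matrix.of fun i j => ⟪a i, b j⟫_ℝ

theorem crossGram_apply {d d' : ℕ} (a : Fin d → Euc n) (b : Fin d' → Euc n) (i : Fin d)
    (j : Fin d') : crossGram a b i j = ⟪a i, b j⟫_ℝ := rfl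

theorem crossGram_transpose {d d' : ℕ} (a : Fin d → Euc n) (b : Fin d' → Euc n) :
    (crossGram a b).transpose = crossGram b a := by
  ext i j
  simp [crossGram_apply, real_inner_comm]

theorem crossGram_changeFrame_left {d d' d'' : ℕ} (A : Matrix (Fin d) (Fin d') ℝ)
    (a : Fin d' → Euc n) (b : Fin d'' → Euc n) :
    crossGram (changeFrame A a) b = A * crossGram a b := by
  ext i j
  simp [crossGram_apply, changeFrame, Matrix.mul_apply, sum_inner, real_inner_smul_left]

theorem crossGram_changeFrame_right {d d' d'' : ℕ} (A : Matrix (Fin d) (Fin d') ℝ)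
    (a : Fin d' → Euc n) (b : Fin d'' → Euc n) :
    crossGram b (changeFrame A a) = crossGram b a * A.transpose := by
  rw [← crossGram_transpose, crossGram_changeFrame_left, Matrix.transpose_mul, crossGram_transpose]

theorem crossGram_self_eq_one_iff {d : ℕ} (a : Fin d → Euc n) :
    crossGram a a = 1 ↔ Orthonormal ℝ a :=
  Matrix.gram_eq_one_iff_orthonormal

theorem changeFrame_changeFrame {d d' d'' : ℕ} (A : Matrix (Fin d) (Fin d') ℝ)
    (B : Matrix (Fin d') (Fin d'') ℝ) (a : Fin d'' → Euc n) :
    changeFrame A (changeFrame B a) = changeFrame (A * B) a := by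
  ext1 i
  simp_rw [changeFrame, Finset.smul_sum, smul_smul]
  rw [Finset.sum_comm]
  simp_rw [← Finset.sum_smul, ← Matrix.mul_apply]

theorem sameOrientation_iff {d : ℕ} {b b' : Fin d → Euc n} :
    SameOrientation b b' ↔ ∃ A : Matrix (Fin d) (Fin d) ℝ, 0 < A.det ∧ b' = changeFrame A b := by
  simp only [SameOrientation, funext_iff, changeFrame]

theorem det_crossGram_self_pos {d : ℕ} {a : Fin d → Euc n} (ha : LinearIndependent ℝ a) :
    0 < (crossGram a a).det :=
  (Matrix.posDef_gram_of_linearIndependent (𝕜 := ℝ) ha).det_pos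

/-- The matrix that changes the sign of the first vector of a frame. -/
def signFlip (d : ℕ) : Matrix (Fin (d + 1)) (Fin (d + 1)) ℝ :=
  Matrix.diagonal (Fin.cons (-1) fun _ => 1)

theorem det_signFlip (d : ℕ) : (signFlip d).det = -1 := by
  simp [signFlip, Matrix.det_diagonal, Fin.prod_univ_succ]

theorem signFlip_mul_transpose (d : ℕ) : signFlip d * (signFlip d).transpose = 1 := by
  rw [signFlip, Matrix.diagonal_transpose, Matrix.diagonal_mul_diagonal, ← Matrix.diagonal_one]
  congr 1
  ext i
  refine Fin.cases ?_ (fun i => ?_) i <;> simp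

theorem orthonormal_changeFrame {d : ℕ} {A : Matrix (Fin d) (Fin d) ℝ} (hA : A * A.transpose = 1)
    {a : Fin d → Euc n} (ha : Orthonormal ℝ a) : Orthonormal ℝ (changeFrame A a) := by
  rw [← crossGram_self_eq_one_iff] at ha ⊢
  rw [crossGram_changeFrame_left, crossGram_changeFrame_right, ha, Matrix.one_mul, hA]

/-- Any orthonormal basis of the span will do after its first vector is negated if necessary; this
correction is where `1 ≤ m` enters. -/
theorem exists_orthonormal_sameOrientation (hm : 1 ≤ m) {a : Fin m → Euc n}
    (ha : LinearIndependent ℝ a) : ∃ e, SameOrientation a e ∧ Orthonormal ℝ e := by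
  obtain ⟨d, rfl⟩ : ∃ d, m = d + 1 := ⟨m - 1, by omega⟩
  have hfr : Module.finrank ℝ (Submodule.span ℝ (range a)) = d + 1 := by
    rw [finrank_span_eq_card ha, Fintype.card_fin]
  let b := (stdOrthonormalBasis ℝ (Submodule.span ℝ (range a))).reindex (finCongr hfr)
  have hb : Orthonormal ℝ (fun i => (b i : Euc n)) :=
    b.orthonormal.comp_linearIsometry (Submodule.span ℝ (range a)).subtypeₗᵢ
  have hex : ∀ i, ∃ c : Fin (d + 1) → ℝ, ∑ j, c j • a j = (b i : Euc n) := fun i =>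
    (Submodule.mem_span_range_iff_exists_fun ℝ).1 (b i).2
  choose A hA using hex
  have hbA : (fun i => (b i : Euc n)) = changeFrame (Matrix.of A) a := by
    ext1 i
    exact (hA i).symm
  rw [hbA] at hb
  have hdet : (Matrix.of A).det ≠ 0 := by
    intro h0
    have := congrArg Matrix.det ((crossGram_self_eq_one_iff _).2 hb)
    rw [crossGram_changeFrame_left, Matrix.det_mul, h0] at this
    simp at this
  rcases lt_or_gt_of_ne hdet with h | h
  · refine ⟨changeFrame (signFlip d) (changeFrame (Matrix.of A) a), ?_,
      orthonormal_changeFrame (signFlip_mul_transpose d) hb⟩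
    rw [sameOrientation_iff]
    refine ⟨signFlip d * Matrix.of A, ?_, changeFrame_changeFrame _ _ _⟩
    rw [Matrix.det_mul, det_signFlip]
    linarith
  · exact ⟨_, sameOrientation_iff.2 ⟨_, h, rfl⟩, hb⟩

/-! ### Reflections of frames -/

/-- The reflection in the hyperplane orthogonal to `z`. -/
def hyperplaneReflection (z : Euc n) : Euc n ≃ₗᵢ[ℝ] Euc n := (ℝ ∙ z)ᗮ.reflection

theorem hyperplaneReflection_apply (z v : Euc n) :
    hyperplaneReflection z v = v - (2 * (⟪z, v⟫_ℝ / ‖z‖ ^ 2)) • z := by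
  rw [hyperplaneReflection, Submodule.reflection_orthogonal_apply,
    Submodule.reflection_singleton_apply]
  simp only [RCLike.ofReal_real_eq_id, id, neg_sub, mul_smul]
  norm_num [two_smul]

theorem hyperplaneReflection_sub {v w : Euc n} (h : ‖v‖ = ‖w‖) :
    hyperplaneReflection (w - v) v = w := by
  have : hyperplaneReflection (w - v) v = hyperplaneReflection (v - w) v := by
    rw [hyperplaneReflection_apply, hyperplaneReflection_apply, ← neg_sub v w, norm_neg,
      inner_neg_left, smul_neg, ← neg_smul]
    congr 2
    ring
  rw [this]
  exact Submodule.reflection_sub h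

/-- The image of a frame under the reflection in the hyperplane orthogonal to `z`. -/
def reflFrame {d : ℕ} (z : Euc n) (a : Fin d → Euc n) : Fin d → Euc n :=
  fun i => hyperplaneReflection z (a i)

theorem reflFrame_changeFrame {d d' : ℕ} (z : Euc n) (A : Matrix (Fin d) (Fin d') ℝ)
    (a : Fin d' → Euc n) : reflFrame z (changeFrame A a) = changeFrame A (reflFrame z a) := by
  ext1 i
  simp [reflFrame, changeFrame, map_sum]

theorem crossGram_reflFrame_reflFrame {d d' : ℕ} (z : Euc n) (a : Fin d → Euc n)
    (b : Fin d' → Euc n) : crossGram (reflFrame z a) (reflFrame z b) = crossGram a b := by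
  ext i j
  simp [crossGram_apply, reflFrame]

theorem det_one_sub_vecMulVec {d : ℕ} (u v : Fin d → ℝ) :
    (1 - Matrix.vecMulVec u v).det = 1 - v ⬝ᵥ u := by
  have := Matrix.det_one_add_replicateCol_mul_replicateRow (ι := Unit) (-u) v
  rw [← Matrix.vecMulVec_eq, Matrix.neg_vecMulVec, ← sub_eq_add_neg] at this
  rw [this, dotProduct_neg, sub_eq_add_neg]

/-- On a subspace that contains `z`, the reflection in the hyperplane orthogonal to `z` has
determinant `-1`. -/
theorem exists_reflFrame_eq_changeFrame {d : ℕ} {z : Euc n} (hz : z ≠ 0) {a : Fin d → Euc n}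
    (h : z ∈ Submodule.span ℝ (range a)) :
    ∃ W : Matrix (Fin d) (Fin d) ℝ, W.det = -1 ∧ reflFrame z a = changeFrame W a := by
  obtain ⟨t, ht⟩ := (Submodule.mem_span_range_iff_exists_fun ℝ).1 h
  -- Substituting `z = ∑ tⱼ aⱼ` in the reflection formula gives a rank-one perturbation of the
  -- identity. Its determinant is `1 - 2`, because `∑ tᵢ ⟪z, aᵢ⟫ = ‖z‖²`.
  refine ⟨1 - Matrix.vecMulVec (fun j => 2 * (⟪z, a j⟫_ℝ / ‖z‖ ^ 2)) t, ?_, ?_⟩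
  · rw [det_one_sub_vecMulVec, dotProduct]
    have h1 : ∑ i, t i * (2 * (⟪z, a i⟫_ℝ / ‖z‖ ^ 2)) = 2 * ((∑ i, t i * ⟪z, a i⟫_ℝ) / ‖z‖ ^ 2) := by
      rw [Finset.sum_div, Finset.mul_sum]
      exact Finset.sum_congr rfl fun i _ => by ring
    have h2 : ∑ i, t i * ⟪z, a i⟫_ℝ = ‖z‖ ^ 2 := by
      rw [← real_inner_self_eq_norm_sq]
      conv_rhs => rw [← ht]
      rw [ht, ← ht, inner_sum]
      simp [real_inner_smul_right]
    rw [h1, h2, div_self (by positivity)]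
    norm_num
  · ext1 i
    simp only [reflFrame, hyperplaneReflection_apply, changeFrame, Matrix.sub_apply, sub_smul,
      Finset.sum_sub_distrib, Matrix.one_apply, ite_smul, one_smul, zero_smul, Finset.sum_ite_eq,
      Finset.mem_univ, if_true, Matrix.vecMulVec_apply]
    simp_rw [mul_smul _ (t _), ← Finset.smul_sum, ht]

/-! ### Sphere frames -/

theorem cons_changeFrame {d d' : ℕ} (A : Matrix (Fin d) (Fin d') ℝ) (w : Euc n)
    (a : Fin d' → Euc n) :
    (Fin.cons w (changeFrame A a) : Fin (d + 1) → Euc n) =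
      changeFrame (Matrix.of (Fin.cons (Fin.cons 1 fun _ => 0) fun i => Fin.cons 0 (A i)))
        (Fin.cons w a) := by
  ext1 i
  refine Fin.cases ?_ (fun i => ?_) i <;> simp [changeFrame, Fin.sum_univ_succ]

theorem det_of_cons {d : ℕ} (A : Matrix (Fin d) (Fin d) ℝ) :
    (Matrix.of (Fin.cons (Fin.cons 1 fun _ => 0) fun i => Fin.cons 0 (A i)) :
      Matrix (Fin (d + 1)) (Fin (d + 1)) ℝ).det = A.det := by
  rw [Matrix.det_succ_column_zero, Fin.sum_univ_succ]
  simp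
  rfl

theorem reflFrame_cons {d : ℕ} (z w : Euc n) (a : Fin d → Euc n) :
    reflFrame z (Fin.cons w a : Fin (d + 1) → Euc n) =
      Fin.cons (hyperplaneReflection z w) (reflFrame z a) := by
  ext1 i
  refine Fin.cases ?_ (fun i => ?_) i <;> simp [reflFrame]

/-- Pairing with `w`, which is orthogonal to both frames, shows that the first column of `Q` is `(1,
0, …, 0)`. So `C` is the lower right block, with the same determinant. -/
theorem exists_changeFrame_of_cons {d : ℕ} {w : Euc n} (hw : w ≠ 0) {a u : Fin d → Euc n}
    (ha : ∀ i, ⟪w, a i⟫_ℝ = 0) (hu : ∀ i, ⟪w, u i⟫_ℝ = 0)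
    {Q : Matrix (Fin (d + 1)) (Fin (d + 1)) ℝ}
    (h : (Fin.cons w u : Fin (d + 1) → Euc n) = changeFrame Q (Fin.cons w a)) :
    ∃ C : Matrix (Fin d) (Fin d) ℝ, C.det = Q.det ∧ u = changeFrame C a := by
  have hw' : ⟪w, w⟫_ℝ ≠ 0 := inner_self_ne_zero.2 hw
  have key : ∀ i, ⟪w, (Fin.cons w u : Fin (d + 1) → Euc n) i⟫_ℝ = Q i 0 * ⟪w, w⟫_ℝ := by
    intro i
    rw [h, changeFrame, Fin.sum_univ_succ]
    simp [inner_add_right, inner_sum, real_inner_smul_right, ha]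
  have h0 : Q 0 0 = 1 := by
    have := key 0
    rw [Fin.cons_zero] at this
    exact (mul_right_cancel₀ hw' (by rw [one_mul]; exact this)).symm
  have hs : ∀ i : Fin d, Q i.succ 0 = 0 := by
    intro i
    have := key i.succ
    rw [Fin.cons_succ, hu, eq_comm] at this
    exact (mul_eq_zero.1 this).resolve_right hw'
  refine ⟨Q.submatrix Fin.succ Fin.succ, ?_, ?_⟩
  · rw [Matrix.det_succ_column_zero Q, Fin.sum_univ_succ]
    simp [h0, hs]
  · ext1 i
    have := congrFun h i.succ
    rw [Fin.cons_succ, changeFrame, Fin.sum_univ_succ] at this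
    simpa [hs, changeFrame] using this

/-- The reflection sends the radius `x - c` to `y - c` and has determinant `-1` on the space spanned
by the radius and the tangent plane. Splitting off the radius, it reverses the orientations of the
tangent spaces. In the planar case it preserves the plane, again with determinant `-1`. -/
theorem IsSphereFrame.exists_changeFrame {x y : Euc n} (hxy : y - x ≠ 0) {e u : Fin m → Euc n}
    (h : IsSphereFrame x y e u) :
    ∃ C : Matrix (Fin m) (Fin m) ℝ, C.det < 0 ∧ u = changeFrame C (reflFrame (y - x) e) := by
  have inv_change : ∀ {d : ℕ} {e' : Fin d → Euc n} {A W : Matrix (Fin d) (Fin d) ℝ}, 0 < A.det →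
      W.det = -1 → reflFrame (y - x) e' = changeFrame W e' →
      ∃ Q : Matrix (Fin d) (Fin d) ℝ, Q.det < 0 ∧
        changeFrame A e' = changeFrame Q (reflFrame (y - x) e') := by
    intro d e' A W hA hW hr
    have hWu : IsUnit W.det := by rw [hW]; exact isUnit_one.neg
    refine ⟨A * W⁻¹, ?_, ?_⟩
    · rw [Matrix.det_mul, Matrix.det_nonsing_inv, Ring.inverse_eq_inv', hW]
      norm_num [hA]
    · rw [hr, changeFrame_changeFrame, Matrix.mul_assoc, Matrix.nonsing_inv_mul _ hWu,
        Matrix.mul_one]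
  rcases h with ⟨hspan, hso⟩ | ⟨c, hcx, hec, hdist, hspan, hu, hso⟩
  · obtain ⟨W, hW, hr⟩ := exists_reflFrame_eq_changeFrame hxy hspan
    obtain ⟨A, hA, rfl⟩ := sameOrientation_iff.1 hso
    exact inv_change hA hW hr
  · have hnorm : ‖x - c‖ = ‖y - c‖ := by
      rw [dist_eq_norm, dist_eq_norm] at hdist
      exact hdist.symm
    have hR : hyperplaneReflection (y - x) (x - c) = y - c := by
      have := hyperplaneReflection_sub hnorm
      rwa [sub_sub_sub_cancel_right] at this
    have hmem : y - x ∈ Submodule.span ℝ (range (Fin.cons (x - c) e : Fin (m + 1) → Euc n)) := by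
      rw [Fin.range_cons, ← sub_sub_sub_cancel_right y x c]
      exact Submodule.sub_mem _ hspan (Submodule.subset_span (mem_insert _ _))
    obtain ⟨W, hW, hr⟩ := exists_reflFrame_eq_changeFrame hxy hmem
    obtain ⟨A, hA, hA'⟩ := sameOrientation_iff.1 hso
    obtain ⟨Q, hQ, hQ'⟩ := inv_change hA hW hr
    rw [← hA', reflFrame_cons, hR] at hQ'
    have hyc : y - c ≠ 0 := by
      rw [← norm_ne_zero_iff, ← hnorm, norm_ne_zero_iff]
      exact sub_ne_zero.2 hcx.symm
    obtain ⟨C, hC, hCu⟩ := exists_changeFrame_of_cons hyc (a := reflFrame (y - x) e) (u := u)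
      (fun i => by
        rw [← hR, reflFrame, LinearIsometryEquiv.inner_map_map, real_inner_comm, hec])
      (fun i => by rw [real_inner_comm, hu]) hQ'
    exact ⟨C, hC ▸ hQ, hCu⟩

/-- Existence of the sphere: the sign flip compensates the orientation reversal of the reflection.
-/
theorem isSphereFrame_signFlip {d : ℕ} {x y : Euc n} (hxy : y - x ≠ 0) {e : Fin (d + 1) → Euc n}
    (he : Orthonormal ℝ e) :
    IsSphereFrame x y e (changeFrame (signFlip d) (reflFrame (y - x) e)) := by
  by_cases hspan : y - x ∈ Submodule.span ℝ (range e)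
  · refine Or.inl ⟨hspan, ?_⟩
    obtain ⟨W, hW, hr⟩ := exists_reflFrame_eq_changeFrame hxy hspan
    rw [hr, changeFrame_changeFrame, sameOrientation_iff]
    refine ⟨_, ?_, rfl⟩
    rw [Matrix.det_mul, det_signFlip, hW]
    norm_num
  · refine Or.inr ?_
    set p := ∑ i, ⟪e i, y - x⟫_ℝ • e i with hp
    have hpm : p ∈ Submodule.span ℝ (range e) :=
      Submodule.sum_mem _ fun i _ => Submodule.smul_mem _ _ (Submodule.subset_span ⟨i, rfl⟩)
    set w := y - x - p with hw
    have hw0 : w ≠ 0 := fun h0 => hspan (by rw [sub_eq_zero.1 h0]; exact hpm)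
    have hew : ∀ i, ⟪e i, w⟫_ℝ = 0 := fun i => by
      rw [hw, inner_sub_right, hp, he.inner_right_fintype, sub_self]
    have hpw : ⟪p, w⟫_ℝ = 0 := by
      rw [hp, sum_inner]
      simp [real_inner_smul_left, hew]
    have hyw : ⟪y - x, w⟫_ℝ = ‖w‖ ^ 2 := by
      have : y - x = w + p := by rw [hw]; abel
      rw [this, inner_add_left, hpw, real_inner_self_eq_norm_sq, add_zero]
    have hw2 : ‖w‖ ^ 2 ≠ 0 := by positivity
    have hz2 : ‖y - x‖ ^ 2 ≠ 0 := by positivity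
    -- The centre must lie on the normal line through `x` in the direction `w`, the part of `y - x`
    -- orthogonal to the tangent plane. Equidistance of `x - l • w` from `x` and `y` reads `‖y - x‖²
    -- + 2 l ‖w‖² = 0`.
    set l : ℝ := -(‖y - x‖ ^ 2 / (2 * ‖w‖ ^ 2)) with hl
    have hl0 : l ≠ 0 := neg_ne_zero.2 (by positivity)
    have hxc : x - (x - l • w) = l • w := by abel
    have hyc : y - (x - l • w) = (y - x) + l • w := by abel
    have hnorm : ‖x - (x - l • w)‖ = ‖y - (x - l • w)‖ := by
      rw [hxc, hyc, ← sq_eq_sq₀ (norm_nonneg _) (norm_nonneg _), norm_add_sq_real,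
        real_inner_smul_right, hyw, hl]
      field_simp
      ring
    have hR : hyperplaneReflection (y - x) (x - (x - l • w)) = y - (x - l • w) := by
      have := hyperplaneReflection_sub hnorm
      rwa [sub_sub_sub_cancel_right] at this
    have hins : y - (x - l • w) ∈ Submodule.span ℝ (insert (x - (x - l • w)) (range e)) := by
      have h1 : l • w ∈ Submodule.span ℝ (insert (l • w) (range e)) :=
        Submodule.subset_span (mem_insert _ _)
      have h2 : w ∈ Submodule.span ℝ (insert (l • w) (range e)) := by
        have := Submodule.smul_mem _ l⁻¹ h1
        rwa [smul_smul, inv_mul_cancel₀ hl0, one_smul] at this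
      rw [hxc, hyc]
      refine Submodule.add_mem _ ?_ h1
      have : y - x = w + p := by rw [hw]; abel
      rw [this]
      exact Submodule.add_mem _ h2 (Submodule.span_mono (subset_insert _ _) hpm)
    refine ⟨x - l • w, ?_, fun i => ?_, ?_, hins, fun i => ?_, ?_⟩
    · rw [ne_comm, ← sub_ne_zero, hxc]
      exact smul_ne_zero hl0 hw0
    · rw [hxc, real_inner_smul_right, hew, mul_zero]
    · rw [dist_eq_norm, dist_eq_norm, hnorm]
    · rw [← hR, changeFrame, sum_inner]
      refine Finset.sum_eq_zero fun j _ => ?_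
      rw [real_inner_smul_left, reflFrame, LinearIsometryEquiv.inner_map_map, hxc,
        real_inner_smul_right, hew, mul_zero, mul_zero]
    · have hmem : y - x ∈
          Submodule.span ℝ (range (Fin.cons (x - (x - l • w)) e : Fin (d + 1 + 1) → Euc n)) := by
        rw [Fin.range_cons, ← sub_sub_sub_cancel_right y x (x - l • w)]
        exact Submodule.sub_mem _ hins (Submodule.subset_span (mem_insert _ _))
      obtain ⟨W, hW, hr⟩ := exists_reflFrame_eq_changeFrame hxy hmem
      rw [cons_changeFrame, ← hR, ← reflFrame_cons, hr, changeFrame_changeFrame,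
        sameOrientation_iff]
      refine ⟨_, ?_, rfl⟩
      rw [Matrix.det_mul, det_of_cons, det_signFlip, hW]
      norm_num

/-! ### A formula for the combined angle -/

/-- The cosine of the combined angle in terms of frames `a` and `b` of the tangent spaces at two
points with difference `z`. -/
def angleCos (z : Euc n) (a b : Fin m → Euc n) : ℝ :=
  -(crossGram (reflFrame z a) b).det / (√(crossGram a a).det * √(crossGram b b).det)

theorem det_eq_inv_sqrt {A : Matrix (Fin m) (Fin m) ℝ} {a : Fin m → Euc n}
    (h : Orthonormal ℝ (changeFrame A a)) :
    |A.det| = (√(crossGram a a).det)⁻¹ ∧ 0 < (crossGram a a).det := by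
  have h1 := congrArg Matrix.det ((crossGram_self_eq_one_iff _).2 h)
  rw [crossGram_changeFrame_left, crossGram_changeFrame_right, Matrix.det_mul, Matrix.det_mul,
    Matrix.det_transpose, Matrix.det_one] at h1
  have h2 : A.det ^ 2 * (crossGram a a).det = 1 := by rw [← h1]; ring
  have h3 : 0 < (crossGram a a).det := by
    by_contra hneg
    nlinarith [sq_nonneg A.det]
  refine ⟨?_, h3⟩
  rw [← Real.sqrt_inv, ← Real.sqrt_sq_eq_abs, eq_inv_of_mul_eq_one_left h2]

/-- Orthonormality fixes the absolute values of the determinants of the changes of frame, and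
orientation fixes their signs. Hence the value does not depend on the choices, and the one negative
sign becomes the minus in `angleCos`. -/
theorem IsCosCombinedAngle.eq_angleCos {T : Euc n → Set (Fin m → Euc n)} {x y : Euc n}
    (hxy : y - x ≠ 0) {a b : Fin m → Euc n} (ha : ∀ e ∈ T x, SameOrientation a e)
    (hb : ∀ e ∈ T y, SameOrientation b e) {r : ℝ} (h : IsCosCombinedAngle T x y r) :
    r = angleCos (y - x) a b := by
  obtain ⟨e, he, u, hs, hu, v, hv, hvo, rfl⟩ := h
  obtain ⟨A, hA, rfl⟩ := sameOrientation_iff.1 (ha e he)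
  obtain ⟨B, hB, rfl⟩ := sameOrientation_iff.1 (hb v hv)
  obtain ⟨C, hC, rfl⟩ := hs.exists_changeFrame hxy
  change (crossGram _ _).det = _
  have h1 := (det_eq_inv_sqrt hvo).1
  rw [reflFrame_changeFrame, changeFrame_changeFrame] at hu ⊢
  have h2 := (det_eq_inv_sqrt hu).1
  rw [crossGram_reflFrame_reflFrame] at h2
  rw [abs_of_pos hB] at h1
  rw [Matrix.det_mul, abs_of_neg (mul_neg_of_neg_of_pos hC hA)] at h2
  rw [crossGram_changeFrame_left, crossGram_changeFrame_right, Matrix.det_mul, Matrix.det_mul,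
    Matrix.det_mul, Matrix.det_transpose, h1, angleCos, div_eq_mul_inv, mul_inv, ← h2]
  ring

theorem cosCombinedAngle_eq_angleCos (hm : 1 ≤ m) {T : Euc n → Set (Fin m → Euc n)} {x y : Euc n}
    (hxy : y - x ≠ 0) {a b : Fin m → Euc n} (ha : ∀ e, e ∈ T x ↔ SameOrientation a e)
    (hb : ∀ e, e ∈ T y ↔ SameOrientation b e) (hla : LinearIndependent ℝ a)
    (hlb : LinearIndependent ℝ b) : cosCombinedAngle T x y = angleCos (y - x) a b := by
  refine IsCosCombinedAngle.eq_angleCos hxy (fun e => (ha e).1) (fun e => (hb e).1) ?_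
  -- Uniqueness identifies the value chosen by `Classical.epsilon` once some admissible value
  -- exists.
  refine Classical.epsilon_spec (p := IsCosCombinedAngle T x y) ?_
  obtain ⟨e, hae, he⟩ := exists_orthonormal_sameOrientation hm hla
  obtain ⟨v, hbv, hv⟩ := exists_orthonormal_sameOrientation hm hlb
  obtain ⟨d, rfl⟩ : ∃ d, m = d + 1 := ⟨m - 1, by omega⟩
  refine ⟨_, e, (ha e).2 hae, _, isSphereFrame_signFlip hxy he, ?_, v, (hb v).2 hbv, hv, rfl⟩
  refine orthonormal_changeFrame (signFlip_mul_transpose d) ?_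
  rw [← crossGram_self_eq_one_iff, crossGram_reflFrame_reflFrame, crossGram_self_eq_one_iff]
  exact he

/-! ### Asymptotics of the combined angle near the diagonal -/

section Asymptotics

variable {α : Type*} {l : Filter α}

/-- Telescoping: the factors are exchanged one at a time while the others stay bounded. -/
theorem isBigO_prod_sub {ι : Type*} (s : Finset ι) {A B : ι → α → ℝ} {g : α → ℝ}
    (hA : ∀ i, A i =O[l] fun _ => (1 : ℝ)) (hB : ∀ i, B i =O[l] fun _ => (1 : ℝ))
    (hAB : ∀ i, (fun x => A i x - B i x) =O[l] g) :
    (fun x => ∏ i ∈ s, A i x - ∏ i ∈ s, B i x) =O[l] g := by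
  classical
  induction s using Finset.induction_on with
  | empty => simpa using isBigO_zero g l
  | insert i s hi ih =>
    have hBs : (fun x => ∏ i ∈ s, B i x) =O[l] fun _ => (1 : ℝ) := by
      simpa using IsBigO.finsetProd (s := s) fun i _ => hB i
    have h1 : (fun x => A i x * (∏ i ∈ s, A i x - ∏ i ∈ s, B i x)) =O[l] g := by
      simpa using (hA i).mul ih
    have h2 : (fun x => (A i x - B i x) * ∏ i ∈ s, B i x) =O[l] g := by
      simpa using (hAB i).mul hBs
    refine (h1.add h2).congr_left fun x => ?_
    rw [Finset.prod_insert hi, Finset.prod_insert hi]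
    ring

theorem isBigO_det_sub {d : ℕ} {A B : α → Matrix (Fin d) (Fin d) ℝ} {g : α → ℝ}
    (hA : ∀ i j, (fun x => A x i j) =O[l] fun _ => (1 : ℝ))
    (hB : ∀ i j, (fun x => B x i j) =O[l] fun _ => (1 : ℝ))
    (hAB : ∀ i j, (fun x => A x i j - B x i j) =O[l] g) :
    (fun x => (A x).det - (B x).det) =O[l] g := by
  simp_rw [Matrix.det_apply, ← Finset.sum_sub_distrib]
  refine IsBigO.fun_sum fun σ _ => ?_
  simp_rw [← smul_sub, Units.smul_def, zsmul_eq_mul]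
  exact (isBigO_prod_sub Finset.univ (fun i => hA _ _) (fun i => hB _ _)
    fun i => hAB _ _).const_mul_left _

theorem isBigO_mul_apply {d d' d'' : ℕ} {A : α → Matrix (Fin d) (Fin d') ℝ}
    {B : α → Matrix (Fin d') (Fin d'') ℝ} {f g : α → ℝ}
    (hA : ∀ i j, (fun x => A x i j) =O[l] f) (hB : ∀ i j, (fun x => B x i j) =O[l] g)
    (i : Fin d) (j : Fin d'') : (fun x => (A x * B x) i j) =O[l] fun x => f x * g x := by
  simp_rw [Matrix.mul_apply]
  exact IsBigO.fun_sum fun _ _ => (hA _ _).mul (hB _ _)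

theorem isBigO_inner {v w : α → Euc n} {f g : α → ℝ} (hv : v =O[l] f) (hw : w =O[l] g) :
    (fun x => ⟪v x, w x⟫_ℝ) =O[l] fun x => f x * g x := by
  refine IsBigO.trans ?_ (hv.norm_left.mul hw.norm_left)
  refine IsBigO.of_bound 1 (Eventually.of_forall fun x => ?_)
  rw [one_mul, norm_mul, norm_norm, norm_norm]
  exact norm_inner_le_norm _ _

theorem tendsto_det_crossGram {d : ℕ} {a b : α → Fin d → Euc n} {a₀ b₀ : Fin d → Euc n}
    (ha : ∀ i, Tendsto (fun x => a x i) l (𝓝 (a₀ i)))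
    (hb : ∀ i, Tendsto (fun x => b x i) l (𝓝 (b₀ i))) :
    Tendsto (fun x => (crossGram (a x) (b x)).det) l (𝓝 (crossGram a₀ b₀).det) := by
  have h : Tendsto (fun x => crossGram (a x) (b x)) l (𝓝 (crossGram a₀ b₀)) :=
    tendsto_pi_nhds.2 fun i => tendsto_pi_nhds.2 fun j => (ha i).inner (hb j)
  exact ((continuous_id.matrix_det).tendsto _).comp h

theorem isBigO_inv_crossGram {d : ℕ} {a : α → Fin d → Euc n} {a₀ : Fin d → Euc n}
    (h₀ : LinearIndependent ℝ a₀) (ha : ∀ i, Tendsto (fun x => a x i) l (𝓝 (a₀ i)))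
    (i j : Fin d) : (fun x => (crossGram (a x) (a x))⁻¹ i j) =O[l] fun _ => (1 : ℝ) := by
  have h : Tendsto (fun x => crossGram (a x) (a x)) l (𝓝 (crossGram a₀ a₀)) :=
    tendsto_pi_nhds.2 fun i => tendsto_pi_nhds.2 fun j => (ha i).inner (ha j)
  have h2 := ((continuous_id.matrix_adjugate).tendsto _).comp h
  have h3 := tendsto_pi_nhds.1 (tendsto_pi_nhds.1 h2 i) j
  have h4 := (tendsto_det_crossGram ha ha).inv₀ (det_crossGram_self_pos h₀).ne'
  refine ((h4.mul h3).isBigO_one ℝ).congr_left fun x => ?_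
  simp [Matrix.inv_def, Ring.inverse_eq_inv']

end Asymptotics

theorem crossGram_add_right {d d' : ℕ} (a : Fin d → Euc n) (b c : Fin d' → Euc n) :
    crossGram a (b + c) = crossGram a b + crossGram a c := by
  ext i j
  simp [crossGram_apply, inner_add_right]

theorem crossGram_add_left {d d' : ℕ} (a b : Fin d → Euc n) (c : Fin d' → Euc n) :
    crossGram (a + b) c = crossGram a c + crossGram b c := by
  ext i j
  simp [crossGram_apply, inner_add_left]

/-- The Schur complement of the Gram matrix of two frames depends only on the part of the second
one that is orthogonal to the first one. -/
theorem det_crossGram_schur {d : ℕ} {a : Fin d → Euc n} (ha : (crossGram a a).det ≠ 0)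
    (W : Matrix (Fin d) (Fin d) ℝ) (b c : Fin d → Euc n) (hb : b = changeFrame W a + c) :
    (crossGram a a).det * (crossGram b b -
      (crossGram c c - crossGram c a * (crossGram a a)⁻¹ * crossGram a c)).det =
      (crossGram a b).det ^ 2 := by
  have hu : IsUnit (crossGram a a).det := ha.isUnit
  -- Both sides are the Gram matrix of the orthogonal projection of `b` to the span of `a`: the
  -- bracket is the Gram matrix of the component orthogonal to it, which is the same for `b` and
  -- `c`.
  have key : crossGram b b - (crossGram c c - crossGram c a * (crossGram a a)⁻¹ * crossGram a c) =
      crossGram b a * (crossGram a a)⁻¹ * crossGram a b := by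
    rw [hb]
    simp only [crossGram_add_left, crossGram_add_right, crossGram_changeFrame_left,
      crossGram_changeFrame_right]
    simp only [Matrix.add_mul, Matrix.mul_add, Matrix.mul_assoc]
    simp only [Matrix.mul_nonsing_inv_cancel_left _ _ hu, Matrix.nonsing_inv_mul_cancel_left _ _ hu]
    abel
  rw [key, Matrix.det_mul, Matrix.det_mul, Matrix.det_nonsing_inv, Ring.inverse_eq_inv',
    ← crossGram_transpose a b, Matrix.det_transpose]
  field_simp

theorem crossGram_reflFrame_left {d d' : ℕ} (z : Euc n) (a : Fin d → Euc n)
    (b : Fin d' → Euc n) : crossGram (reflFrame z a) b = crossGram a (reflFrame z b) := by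
  ext i j
  simp only [crossGram_apply, reflFrame, hyperplaneReflection_apply, inner_sub_left,
    inner_sub_right, real_inner_smul_left, real_inner_smul_right, real_inner_comm z]
  ring

/-- Up to an error `c = O(δ)`, the reflected frame `R b` lies in the span of `a`. Only the Gram data
of `c` orthogonal to `a` enter the square of the numerator, and these are `O(δ²)`; the first-order
errors cancel. The limit of the numerator is needed only to exclude that the cosine tends to `-1`.
-/
theorem one_sub_angleCos_isBigO {α : Type*} {l : Filter α} {a b : α → Fin m → Euc n}
    {a₀ : Fin m → Euc n} {z : α → Euc n} {t : α → Fin m → ℝ} {δ : α → ℝ}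
    (h₀ : LinearIndependent ℝ a₀) (hδ : Tendsto δ l (𝓝 0))
    (ha : ∀ i, Tendsto (fun x => a x i) l (𝓝 (a₀ i)))
    (hab : ∀ i, (fun x => b x i - a x i) =O[l] δ) (hz : ∀ᶠ x in l, ‖z x‖ = 1)
    (ht : ∀ i, (fun x => t x i) =O[l] fun _ => (1 : ℝ))
    (hzt : (fun x => z x - ∑ i, t x i • a x i) =O[l] δ) :
    (fun x => 1 - angleCos (z x) (a x) (b x)) =O[l] fun x => δ x ^ 2 := by
  have hδ1 : δ =O[l] fun _ => (1 : ℝ) := hδ.isBigO_one ℝ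
  have hb : ∀ i, Tendsto (fun x => b x i) l (𝓝 (a₀ i)) := fun i => by
    simpa using ((hab i).trans_tendsto hδ).add (ha i)
  have hz1 : z =O[l] fun _ => (1 : ℝ) := IsBigO.of_bound 1 (hz.mono fun x hx => by simp [hx])
  have ha1 : ∀ i, (fun x => a x i) =O[l] fun _ => (1 : ℝ) := fun i => (ha i).isBigO_one ℝ
  have hb1 : ∀ i, (fun x => b x i) =O[l] fun _ => (1 : ℝ) := fun i => (hb i).isBigO_one ℝ
  set β : α → Fin m → ℝ := fun x i => 2 * ⟪z x, b x i⟫_ℝ with hβ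
  have hβ1 : ∀ i, (fun x => β x i) =O[l] fun _ => (1 : ℝ) := fun i => by
    simpa only [mul_one] using (isBigO_inner hz1 (hb1 i)).const_mul_left 2
  -- In `R b = b - β z`, replacing `b` by `a` and `z` by `∑ tⱼ aⱼ` leaves the matrix `W = 1 - β tᵀ`
  -- applied to `a`; `c` collects the two errors.
  set c : α → Fin m → Euc n := fun x i =>
    (b x i - a x i) - β x i • (z x - ∑ j, t x j • a x j) with hc
  have hcδ : ∀ i, (fun x => c x i) =O[l] δ := fun i => by
    refine (hab i).sub ?_
    simpa using (hβ1 i).smul hzt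
  set W : α → Matrix (Fin m) (Fin m) ℝ := fun x => 1 - Matrix.vecMulVec (β x) (t x) with hW
  have hW1 : ∀ i j, (fun x => W x i j) =O[l] fun _ => (1 : ℝ) := fun i j => by
    simp only [hW, Matrix.sub_apply, Matrix.vecMulVec_apply]
    refine (isBigO_const_const _ one_ne_zero _).sub ?_
    simpa using (hβ1 i).mul (ht j)
  have hbW : ∀ᶠ x in l, reflFrame (z x) (b x) = changeFrame (W x) (a x) + c x := by
    filter_upwards [hz] with x hx
    ext1 i
    simp only [reflFrame, hyperplaneReflection_apply, hx, changeFrame, Pi.add_apply, hW, hc,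
      Matrix.sub_apply, sub_smul, Finset.sum_sub_distrib, Matrix.one_apply, ite_smul, one_smul,
      zero_smul, Finset.sum_ite_eq, Finset.mem_univ, if_true, Matrix.vecMulVec_apply, mul_smul,
      ← Finset.smul_sum, hβ, smul_sub]
    simp only [one_pow, div_one]
    abel
  have hdet0 : 0 < (crossGram a₀ a₀).det := det_crossGram_self_pos h₀
  have hga := tendsto_det_crossGram ha ha
  have hgb := tendsto_det_crossGram hb hb
  have hgpos := hga.eventually (lt_mem_nhds hdet0)
  have hgbpos := hgb.eventually (lt_mem_nhds hdet0)
  have hcg : ∀ {f g : α → ℝ} {u v : α → Fin m → Euc n}, (∀ i, (fun x => u x i) =O[l] f) →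
      (∀ i, (fun x => v x i) =O[l] g) →
      ∀ i j, (fun x => crossGram (u x) (v x) i j) =O[l] fun x => f x * g x :=
    fun hu hv i j => isBigO_inner (hu i) (hv j)
  have hN : ∀ i j, (fun x => crossGram (a x) (c x) i j) =O[l] δ := by
    simpa using hcg ha1 hcδ
  have hN' : ∀ i j, (fun x => crossGram (c x) (a x) i j) =O[l] δ := by
    simpa using hcg hcδ ha1
  have hgb1 : ∀ i j, (fun x => crossGram (b x) (b x) i j) =O[l] fun _ => (1 : ℝ) := by
    simpa using hcg hb1 hb1
  have hga1 : ∀ i j, (fun x => crossGram (a x) (a x) i j) =O[l] fun _ => (1 : ℝ) := by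
    simpa using hcg ha1 ha1
  -- the square of the numerator
  set E : α → Matrix (Fin m) (Fin m) ℝ := fun x => crossGram (c x) (c x) -
    crossGram (c x) (a x) * (crossGram (a x) (a x))⁻¹ * crossGram (a x) (c x) with hE
  have hEδ : ∀ i j, (fun x => E x i j) =O[l] fun x => δ x ^ 2 := fun i j => by
    simp only [hE, Matrix.sub_apply]
    refine IsBigO.sub ?_ ?_
    · simpa [sq] using hcg hcδ hcδ i j
    · have h1 : ∀ i j, (fun x => (crossGram (c x) (a x) * (crossGram (a x) (a x))⁻¹) i j) =O[l] δ :=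
        by simpa using isBigO_mul_apply hN' (isBigO_inv_crossGram h₀ ha)
      simpa [sq] using isBigO_mul_apply h1 hN i j
  have hδ2 : (fun x => δ x ^ 2) =O[l] fun _ => (1 : ℝ) := by simpa using hδ1.pow 2
  have hsq : (fun x => (crossGram (a x) (a x)).det * (crossGram (b x) (b x)).det -
      (crossGram (reflFrame (z x) (a x)) (b x)).det ^ 2) =O[l] fun x => δ x ^ 2 := by
    have h1 : (fun x => (crossGram (b x) (b x)).det - (crossGram (b x) (b x) - E x).det) =O[l]
        fun x => δ x ^ 2 := by
      refine isBigO_det_sub hgb1 (fun i j => ?_) (fun i j => ?_)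
      · exact (hgb1 i j).sub ((hEδ i j).trans hδ2)
      · simpa using hEδ i j
    have h2 : (fun x => (crossGram (a x) (a x)).det *
        ((crossGram (b x) (b x)).det - (crossGram (b x) (b x) - E x).det)) =O[l]
        fun x => δ x ^ 2 := by simpa using (hga.isBigO_one ℝ).mul h1
    refine h2.congr' ?_ EventuallyEq.rfl
    filter_upwards [hbW, hgpos] with x hx hgx
    have := det_crossGram_schur hgx.ne' (W x) _ (c x) hx
    rw [crossGram_reflFrame_reflFrame] at this
    rw [crossGram_reflFrame_left, ← this, mul_sub]
  -- the sign of the numerator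
  have hWdet : (fun x => (W x).det + 1) =O[l] δ := by
    have h1 : (fun x => ⟪z x, (z x - ∑ i, t x i • a x i) -
        ∑ i, t x i • (b x i - a x i)⟫_ℝ) =O[l] δ := by
      have h2 : (fun x => (z x - ∑ i, t x i • a x i) - ∑ i, t x i • (b x i - a x i)) =O[l] δ := by
        refine hzt.sub (IsBigO.fun_sum fun i _ => ?_)
        simpa using (ht i).smul (hab i)
      simpa using isBigO_inner hz1 h2
    refine (h1.const_mul_left 2).congr' ?_ EventuallyEq.rfl
    filter_upwards [hz] with x hx
    have h3 : (z x - ∑ i, t x i • a x i) - ∑ i, t x i • (b x i - a x i) =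
        z x - ∑ i, t x i • b x i := by
      simp only [smul_sub, Finset.sum_sub_distrib]
      abel
    rw [h3, inner_sub_right, real_inner_self_eq_norm_sq, hx, inner_sum]
    simp only [hW, det_one_sub_vecMulVec, dotProduct, hβ, real_inner_smul_right]
    rw [mul_sub, Finset.mul_sum]
    rw [show ∑ i, t x i * (2 * ⟪z x, b x i⟫_ℝ) = ∑ i, 2 * (t x i * ⟪z x, b x i⟫_ℝ) from
      Finset.sum_congr rfl fun i _ => by ring]
    ring
  -- The numerator is `-det (G Wᵀ + O(δ))` with `G` the Gram matrix of `a`, and `det W → -1`.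
  have hM : Tendsto (fun x => -(crossGram (reflFrame (z x) (a x)) (b x)).det) l
      (𝓝 (crossGram a₀ a₀).det) := by
    have hgW : ∀ i j, (fun x => (crossGram (a x) (a x) * (W x).transpose) i j) =O[l]
        fun _ => (1 : ℝ) := by
      simpa using isBigO_mul_apply hga1 (B := fun x => (W x).transpose) (fun i j => hW1 j i)
    have h1 : (fun x => (crossGram (a x) (a x) * (W x).transpose + crossGram (a x) (c x)).det -
        (crossGram (a x) (a x) * (W x).transpose).det) =O[l] δ := by
      refine isBigO_det_sub (fun i j => ?_) hgW (fun i j => ?_)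
      · exact (hgW i j).add ((hN i j).trans hδ1)
      · simpa using hN i j
    have h2 : (fun x => (crossGram (a x) (a x)).det * ((W x).det + 1)) =O[l] δ := by
      simpa using (hga.isBigO_one ℝ).mul hWdet
    have h3 := (hga.sub (h1.trans_tendsto hδ)).sub (h2.trans_tendsto hδ)
    rw [sub_zero, sub_zero] at h3
    refine h3.congr' ?_
    filter_upwards [hbW] with x hx
    rw [crossGram_reflFrame_left, hx, crossGram_add_right, crossGram_changeFrame_right,
      Matrix.det_mul, Matrix.det_transpose]
    ring
  have hD : Tendsto (fun x => √(crossGram (a x) (a x)).det * √(crossGram (b x) (b x)).det) l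
      (𝓝 (crossGram a₀ a₀).det) := by
    have := hga.sqrt.mul hgb.sqrt
    rwa [Real.mul_self_sqrt hdet0.le] at this
  -- With denominator `D` and numerator `N`, write `1 - N / D = (D² - N²) / (D (D + N))`; the last
  -- denominator has a positive limit.
  have hDN := (hD.mul (hD.add hM)).inv₀ (by positivity)
  have hfin := hsq.mul (hDN.isBigO_one ℝ)
  simp only [mul_one] at hfin
  refine hfin.congr' ?_ EventuallyEq.rfl
  filter_upwards [hgpos, hgbpos, (hD.add hM).eventually (lt_mem_nhds (by positivity))]
    with x h1 h2 h3
  rw [angleCos]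
  have h4 := Real.sqrt_pos.2 h1
  have h5 := Real.sqrt_pos.2 h2
  have h6 := Real.sq_sqrt h1.le
  have h7 := Real.sq_sqrt h2.le
  rw [← h6, ← h7]
  simp only [Real.sqrt_sq h4.le, Real.sqrt_sq h5.le]
  have h8 := h3.ne'
  field_simp
  ring

/-! ### Embeddings in charts -/

theorem contDiffAt_comp_chart_symm (hk : 2 ≤ k) {M : ClosedOrientedManifold m k}
    (f : C^k⟮𝓘(ℝ, Euc m), M; 𝓘(ℝ, Euc n), Euc n⟯) {φ : OpenPartialHomeomorph M (Euc m)}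
    (hφ : φ ∈ atlas (Euc m) M) {x : Euc m} (hx : x ∈ φ.target) :
    ContDiffAt ℝ 2 (f ∘ φ.symm) x := by
  have h1 : ContMDiffAt 𝓘(ℝ, Euc m) 𝓘(ℝ, Euc m) k φ.symm x :=
    (contMDiffOn_symm_of_mem_maximalAtlas (IsManifold.subset_maximalAtlas hφ)).contMDiffAt
      (φ.open_target.mem_nhds hx)
  have h2 : ContMDiffAt 𝓘(ℝ, Euc m) 𝓘(ℝ, Euc n) k (f ∘ φ.symm) x :=
    f.contMDiff.contMDiffAt.comp x h1
  exact (contMDiffAt_iff_contDiffAt.1 h2).of_le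
    (WithTop.coe_le_coe.2 hk : ((2 : ℕ∞) : WithTop ℕ∞) ≤ k)

theorem injective_fderiv_comp_chart_symm (hk : 2 ≤ k) {M : ClosedOrientedManifold m k}
    (f : Emb M n) {φ : OpenPartialHomeomorph M (Euc m)}
    (hφ : φ ∈ atlas (Euc m) M) {x : Euc m} (hx : x ∈ φ.target) :
    Function.Injective (fderiv ℝ (f.toMap ∘ φ.symm) x) := by
  have hk1 : (1 : WithTop ℕ∞) ≤ k := by exact_mod_cast one_le_two.trans hk
  have : IsManifold 𝓘(ℝ, Euc m) 1 M := IsManifold.of_le hk1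
  have hf : MDifferentiableAt 𝓘(ℝ, Euc m) 𝓘(ℝ, Euc n) f.toMap (φ.symm x) :=
    f.toMap.contMDiff.mdifferentiable (by positivity) _
  have hs : MDifferentiableAt 𝓘(ℝ, Euc m) 𝓘(ℝ, Euc m) φ.symm x :=
    mdifferentiableAt_atlas_symm hφ hx
  have hφd : MDifferentiableAt 𝓘(ℝ, Euc m) 𝓘(ℝ, Euc m) φ (φ.symm x) :=
    mdifferentiableAt_atlas hφ (φ.map_target hx)
  rw [← mfderiv_eq_fderiv, mfderiv_comp x hf hs]
  have hinv : Function.Injective (mfderiv 𝓘(ℝ, Euc m) 𝓘(ℝ, Euc m) φ.symm x) := by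
    have h := (mdifferentiable_of_mem_atlas (I := 𝓘(ℝ, Euc m)) hφ).comp_symm_deriv hx
    intro v w hvw
    have h' := fun u => DFunLike.congr_fun h u
    have hv := h' v
    have hw := h' w
    simp only [ContinuousLinearMap.comp_apply] at hv hw
    exact hv.symm.trans ((congrArg _ hvw).trans hw)
  exact (f.immersion _).comp hinv

/-- The coordinate frame of `f` in the chart `φ` at `p`. -/
def chartFrame {M : ClosedOrientedManifold m k} (f : M → Euc n)
    (φ : OpenPartialHomeomorph M (Euc m)) (p : M) : Fin m → Euc n :=
  fun i => fderiv ℝ (f ∘ φ.symm) (φ p) (EuclideanSpace.single i 1)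

theorem sum_smul_single (v : Euc m) :
    ∑ i, v i • (EuclideanSpace.single i (1 : ℝ) : Euc m) = v := by
  simpa using (EuclideanSpace.basisFun (Fin m) ℝ).sum_repr v

theorem linearIndependent_chartFrame (hk : 2 ≤ k) {M : ClosedOrientedManifold m k}
    (f : Emb M n) {φ : OpenPartialHomeomorph M (Euc m)}
    (hφ : φ ∈ atlas (Euc m) M) {p : M} (hp : p ∈ φ.source) :
    LinearIndependent ℝ (chartFrame f.toMap φ p) := by
  have h := (EuclideanSpace.basisFun (Fin m) ℝ).toBasis.linearIndependent.map'
    (fderiv ℝ (f.toMap ∘ φ.symm) (φ p) : Euc m →ₗ[ℝ] Euc n)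
    (LinearMap.ker_eq_bot.2 (injective_fderiv_comp_chart_symm hk f hφ (φ.map_source hp)))
  have hc : chartFrame f.toMap φ p = fderiv ℝ (f.toMap ∘ φ.symm) (φ p) ∘
      (EuclideanSpace.basisFun (Fin m) ℝ).toBasis := by
    ext1 i
    simp [chartFrame]
  rw [hc]
  exact h

theorem mem_positiveFrames_iff (hk : 2 ≤ k) {M : ClosedOrientedManifold m k}
    (f : Emb M n) {φ : OpenPartialHomeomorph M (Euc m)}
    (hφ : φ ∈ atlas (Euc m) M) {p : M} (hp : p ∈ φ.source) (e : Fin m → Euc n) :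
    e ∈ positiveFrames f.toMap (f.toMap p) ↔ SameOrientation (chartFrame f.toMap φ p) e := by
  constructor
  · rintro ⟨ψ, hψ, q, hq, hqp, he⟩
    obtain rfl := f.isEmbedding.injective hqp
    -- For the identity, preserving orientation is exactly the condition on the oriented atlas, so
    -- all charts at `p` give the same class of frames.
    have hr : IsOrientationPreserving (Diffeomorph.refl 𝓘(ℝ, Euc m) M k) :=
      fun φ hφ ψ hψ p hp hq => M.oriented φ hφ ψ hψ p ⟨hp, hq⟩
    exact (sameOrientation_coordinateFrame (one_le_two.trans hk) hr (fun _ => rfl) hψ hφ hq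
      hp).trans he
  · exact fun he => ⟨φ, hφ, p, hp, rfl, he⟩

theorem cosCombinedAngle_eq (hm : 1 ≤ m) (hk : 2 ≤ k) {M : ClosedOrientedManifold m k}
    (f : Emb M n) {φ ψ : OpenPartialHomeomorph M (Euc m)} (hφ : φ ∈ atlas (Euc m) M)
    (hψ : ψ ∈ atlas (Euc m) M) {p q : M} (hp : p ∈ φ.source) (hq : q ∈ ψ.source) (hpq : p ≠ q) :
    cosCombinedAngle (positiveFrames f.toMap) (f.toMap p) (f.toMap q) =
      angleCos (f.toMap q - f.toMap p) (chartFrame f.toMap φ p) (chartFrame f.toMap ψ q) :=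
  cosCombinedAngle_eq_angleCos hm
    (sub_ne_zero.2 fun h => hpq (f.isEmbedding.injective h).symm)
    (mem_positiveFrames_iff hk f hφ hp) (mem_positiveFrames_iff hk f hψ hq)
    (linearIndependent_chartFrame hk f hφ hp) (linearIndependent_chartFrame hk f hψ hq)

/-! ### Local `C²` convergence -/

/-- Convergence of embeddings to `f₀` along a filter, in the following local sense: near each point,
in some chart, the maps and their derivatives converge uniformly, and the derivatives are uniformly
Lipschitz. -/
def LocallyC2Tendsto {M : ClosedOrientedManifold m k} (l : Filter (Emb M n)) (f₀ : Emb M n) :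
    Prop :=
  ∀ p₀ : M, ∃ φ ∈ atlas (Euc m) M, p₀ ∈ φ.source ∧ ∃ r > 0, Metric.ball (φ p₀) r ⊆ φ.target ∧
    (∀ ε > 0, ∀ᶠ f in l, ∀ x ∈ Metric.ball (φ p₀) r,
      ‖f.toMap (φ.symm x) - f₀.toMap (φ.symm x)‖ ≤ ε ∧
      ‖fderiv ℝ (f.toMap ∘ φ.symm) x - fderiv ℝ (f₀.toMap ∘ φ.symm) x‖ ≤ ε) ∧
    ∃ C : ℝ, ∀ᶠ f : Emb M n in l, ∀ x ∈ Metric.ball (φ p₀) r, ∀ y ∈ Metric.ball (φ p₀) r,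
      ‖fderiv ℝ (f.toMap ∘ φ.symm) x - fderiv ℝ (f.toMap ∘ φ.symm) y‖ ≤ C * ‖x - y‖

theorem LocallyC2Tendsto.mono {M : ClosedOrientedManifold m k} {l l' : Filter (Emb M n)}
    {f₀ : Emb M n} (h : LocallyC2Tendsto l f₀) (hl : l' ≤ l) : LocallyC2Tendsto l' f₀ := by
  intro p₀
  obtain ⟨φ, hφ, hp, r, hr, hb, h1, C, h2⟩ := h p₀
  exact ⟨φ, hφ, hp, r, hr, hb, fun ε hε => hl (h1 ε hε), C, hl h2⟩

theorem norm_le_sum_norm_single {F : Type*} [NormedAddCommGroup F] [NormedSpace ℝ F]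
    (A : Euc m →L[ℝ] F) : ‖A‖ ≤ ∑ i, ‖A (EuclideanSpace.single i 1)‖ := by
  refine A.opNorm_le_bound (Finset.sum_nonneg fun _ _ => norm_nonneg _) fun v => ?_
  conv_lhs => rw [← sum_smul_single v, map_sum]
  refine (norm_sum_le _ _).trans ?_
  rw [Finset.sum_mul]
  refine Finset.sum_le_sum fun i _ => ?_
  rw [map_smul, norm_smul, mul_comm]
  exact mul_le_mul_of_nonneg_left (PiLp.norm_apply_le v i) (norm_nonneg _)

theorem norm_sub_le_of_forall_iteratedFDeriv {g h : Euc m → Euc n} {x : Euc m} {ε : ℝ}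
    (H : ∀ j ≤ 2, ∀ μ : Fin j → Fin m,
      ‖iteratedFDeriv ℝ j g x (fun i => EuclideanSpace.single (μ i) 1)
        - iteratedFDeriv ℝ j h x (fun i => EuclideanSpace.single (μ i) 1)‖ < ε) :
    ‖g x - h x‖ ≤ ε ∧ ‖fderiv ℝ g x - fderiv ℝ h x‖ ≤ m * ε ∧
      ‖fderiv ℝ (fderiv ℝ g) x - fderiv ℝ (fderiv ℝ h) x‖ ≤ m * (m * ε) := by
  refine ⟨?_, ?_, ?_⟩
  · simpa using (H 0 (by norm_num) Fin.elim0).le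
  · refine (norm_le_sum_norm_single _).trans ?_
    refine (Finset.sum_le_card_nsmul _ _ ε fun i _ => ?_).trans (by simp)
    simpa using (H 1 (by norm_num) fun _ => i).le
  · refine (norm_le_sum_norm_single _).trans ?_
    refine (Finset.sum_le_card_nsmul _ _ (m * ε) fun i _ => ?_).trans (by simp)
    refine (norm_le_sum_norm_single _).trans ?_
    refine (Finset.sum_le_card_nsmul _ _ ε fun j _ => ?_).trans (by simp)
    simpa [iteratedFDeriv_two_apply] using (H 2 le_rfl ![i, j]).le

/-- The neighbourhoods of an embedding in the compact-open `C²` topology are finer than some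
countably generated filter along which there is local `C²` convergence. -/
theorem exists_locallyC2Tendsto (hk : 2 ≤ k) {M : ClosedOrientedManifold m k} (f₀ : Emb M n) :
    ∃ l : Filter (Emb M n), l.IsCountablyGenerated ∧ @nhds _ (embTopology 2 M n) f₀ ≤ l ∧
      LocallyC2Tendsto l f₀ := by
  have hR : ∀ c : M, ∃ R > 0, Metric.closedBall (chartAt (Euc m) c c) R ⊆
      (chartAt (Euc m) c).target := fun c =>
    Metric.nhds_basis_closedBall.mem_iff.1
      ((chartAt (Euc m) c).open_target.mem_nhds (mem_chart_target _ c))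
  choose R hR0 hR using hR
  obtain ⟨s, -, hs⟩ := (isCompact_univ (X := M)).elim_nhds_subcover
    (fun c => (chartAt (Euc m) c).source ∩
      chartAt (Euc m) c ⁻¹' Metric.ball (chartAt (Euc m) c c) (R c))
    (fun c _ => Filter.inter_mem ((chartAt (Euc m) c).open_source.mem_nhds (mem_chart_source _ c))
      (((chartAt (Euc m) c).continuousAt (mem_chart_source _ c)).preimage_mem_nhds
        (Metric.ball_mem_nhds _ (hR0 c))))
  set K : M → Set M := fun c => (chartAt (Euc m) c).symm ''
    Metric.closedBall (chartAt (Euc m) c c) (R c) with hK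
  set S : M → ℝ → Set (Emb M n) := fun c ε => Emb.toMap ⁻¹' subbasicSet 2 f₀.toMap
    (chartAt (Euc m) c) (OpenPartialHomeomorph.refl (Euc n)) (K c) ε with hS
  have hKimg : ∀ c, chartAt (Euc m) c '' K c = Metric.closedBall (chartAt (Euc m) c c) (R c) :=
    fun c => by
      rw [hK, image_image]
      conv_rhs => rw [← image_id (Metric.closedBall (chartAt (Euc m) c c) (R c))]
      exact image_congr fun x hx => (chartAt (Euc m) c).right_inv (hR c hx)
  -- Finitely many compact coordinate balls cover `M`, so only `ε = 1 / (i + 1)` varies. The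
  -- resulting countable generation is what dominated convergence requires later.
  refine ⟨⨅ i : ℕ, 𝓟 (⋂ c ∈ s, S c (1 / (i + 1))), inferInstance, ?_, ?_⟩
  · refine le_iInf fun i => le_principal_iff.2 ?_
    let := embTopology 2 M n
    refine (biInter_finset_mem s).2 fun c _ => ?_
    have hε : (0 : ℝ) < 1 / (i + 1) := by positivity
    have hopen : @IsOpen _ (compactOpenTopology 2) (subbasicSet 2 f₀.toMap
        (chartAt (Euc m) c) (OpenPartialHomeomorph.refl (Euc n)) (K c) (1 / (i + 1))) := by
      refine TopologicalSpace.isOpen_generateFrom_of_mem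
        ⟨f₀.toMap, chartAt (Euc m) c, OpenPartialHomeomorph.refl (Euc n), K c, 1 / (i + 1),
        IsManifold.chart_mem_maximalAtlas c, ?_, ?_, ?_, fun _ _ => mem_univ _, hε, rfl⟩
      · exact IsManifold.subset_maximalAtlas (by simp)
      · exact (isCompact_closedBall _ _).image_of_continuousOn
          ((chartAt (Euc m) c).continuousOn_symm.mono (hR c))
      · rintro _ ⟨x, hx, rfl⟩
        exact (chartAt (Euc m) c).map_target (hR c hx)
    refine IsOpen.mem_nhds (show IsOpen (S c (1 / (i + 1))) from ⟨_, hopen, rfl⟩) ?_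
    exact ⟨fun _ _ => mem_univ _, fun x _ j _ μ => by simpa using hε⟩
  · have hev : ∀ c ∈ s, ∀ ε > 0, ∀ᶠ f in ⨅ i : ℕ, 𝓟 (⋂ c ∈ s, S c (1 / (i + 1))),
        ∀ x ∈ Metric.closedBall (chartAt (Euc m) c c) (R c),
        ‖f.toMap ((chartAt (Euc m) c).symm x) - f₀.toMap ((chartAt (Euc m) c).symm x)‖ ≤ ε ∧
        ‖fderiv ℝ (f.toMap ∘ (chartAt (Euc m) c).symm) x -
          fderiv ℝ (f₀.toMap ∘ (chartAt (Euc m) c).symm) x‖ ≤ ε ∧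
        ‖fderiv ℝ (fderiv ℝ (f.toMap ∘ (chartAt (Euc m) c).symm)) x -
          fderiv ℝ (fderiv ℝ (f₀.toMap ∘ (chartAt (Euc m) c).symm)) x‖ ≤ ε := by
      intro c hc ε hε
      obtain ⟨i, hi⟩ := exists_nat_one_div_lt
        -- Passing from partial derivatives to operator norms costs a factor `m` per order; `m + 1`
        -- keeps the denominators positive.
        (show (0 : ℝ) < min ε (min (ε / (m + 1)) (ε / ((m + 1) * (m + 1)))) by positivity)
      rw [lt_min_iff, lt_min_iff, lt_div_iff₀ (by positivity), lt_div_iff₀ (by positivity)] at hi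
      refine mem_of_superset (mem_iInf_of_mem i (mem_principal_self _)) fun f hf x hx => ?_
      have hfc := (mem_iInter₂.1 hf c hc).2
      rw [hKimg] at hfc
      have hpos : (0 : ℝ) < 1 / (i + 1) := by positivity
      have hm0 : (0 : ℝ) ≤ m := Nat.cast_nonneg m
      have h1 := norm_sub_le_of_forall_iteratedFDeriv (g := f.toMap ∘ (chartAt (Euc m) c).symm)
        (h := f₀.toMap ∘ (chartAt (Euc m) c).symm) (hfc x hx)
      refine ⟨h1.1.trans hi.1.le, h1.2.1.trans ?_, h1.2.2.trans ?_⟩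
      · nlinarith [hi.2.1]
      · nlinarith [hi.2.2, mul_nonneg hm0 hpos.le]
    intro p₀
    obtain ⟨c, hc, hpc⟩ := mem_iUnion₂.1 (hs (mem_univ p₀))
    obtain ⟨r, hr, hrb⟩ := Metric.isOpen_iff.1 Metric.isOpen_ball _ hpc.2
    have hrb' := hrb.trans Metric.ball_subset_closedBall
    refine ⟨chartAt (Euc m) c, chart_mem_atlas _ c, hpc.1, r, hr, hrb'.trans (hR c),
      fun ε hε => (hev c hc ε hε).mono fun f hf x hx => ⟨(hf x (hrb' hx)).1, (hf x (hrb' hx)).2.1⟩,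
      ?_⟩
    have hcont : ContinuousOn (fderiv ℝ (fderiv ℝ (f₀.toMap ∘ (chartAt (Euc m) c).symm)))
        (Metric.closedBall (chartAt (Euc m) c c) (R c)) := fun x hx => by
      have h := (contDiffAt_comp_chart_symm hk f₀.toMap (chart_mem_atlas _ c) (hR c hx)).fderiv_right
        (m := 1) (by norm_num)
      exact ((h.fderiv_right (m := 0) (by norm_num)).continuousAt).continuousWithinAt
    obtain ⟨B, hB⟩ := IsCompact.exists_bound_of_continuousOn
      (E := Euc m →L[ℝ] Euc m →L[ℝ] Euc n) (isCompact_closedBall _ _) hcont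
    -- `B` bounds the second derivative of `f₀` on the compact ball, and nearby embeddings exceed it
    -- by at most `1`. The mean value inequality then gives the Lipschitz bound.
    refine ⟨B + 1, (hev c hc 1 one_pos).mono fun f hf x hx y hy => ?_⟩
    refine (convex_ball _ _).norm_image_sub_le_of_norm_fderiv_le (𝕜 := ℝ) (fun z hz => ?_)
      (fun z hz => ?_) hy hx
    · exact ((contDiffAt_comp_chart_symm hk f.toMap (chart_mem_atlas _ c)
        (hR c (hrb' hz))).fderiv_right (m := 1) (by norm_num)).differentiableAt (by norm_num)
    · have h1 := (hf z (hrb' hz)).2.2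
      have h2 := hB z (hrb' hz)
      have h3 := norm_sub_norm_le (fderiv ℝ (fderiv ℝ (f.toMap ∘ (chartAt (Euc m) c).symm)) z)
        (fderiv ℝ (fderiv ℝ (f₀.toMap ∘ (chartAt (Euc m) c).symm)) z)
      linarith

/-! ### Uniformity from compactness -/

/-- This is the tube lemma for filters. -/
theorem eventually_forall_of_local {X ι : Type*} [TopologicalSpace X] [CompactSpace X]
    {l : Filter ι} {P : X → ι → Prop} (h : ∀ x, ∀ᶠ t in 𝓝 x ×ˢ l, P t.1 t.2) :
    ∀ᶠ i in l, ∀ x, P x i := by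
  have h1 : {t : X × ι | P t.1 t.2} ∈ 𝓝ˢ (univ : Set X) ×ˢ l :=
    isCompact_univ.mem_nhdsSet_prod_of_forall fun x _ => h x
  rw [nhdsSet_univ] at h1
  obtain ⟨s, hs, t, ht, hst⟩ := mem_prod_iff.1 h1
  rw [mem_top] at hs
  filter_upwards [ht] with i hi x
  exact hst (show (x, i) ∈ s ×ˢ t from ⟨hs ▸ mem_univ x, hi⟩)

/-- The local bounds depend on the point. Treating the bound as a further parameter tending to
infinity reduces the claim to `eventually_forall_of_local`. -/
theorem exists_bound_of_local {X ι : Type*} [TopologicalSpace X] [CompactSpace X]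
    {l : Filter ι} {F : X → ι → ℝ} (h : ∀ x, ∃ B, ∀ᶠ t in 𝓝 x ×ˢ l, F t.1 t.2 ≤ B) :
    ∃ B, ∀ᶠ i in l, ∀ x, F x i ≤ B := by
  have h1 : ∀ᶠ t in (atTop : Filter ℝ) ×ˢ l, ∀ x, F x t.2 ≤ t.1 := by
    refine eventually_forall_of_local fun x => ?_
    obtain ⟨B, hB⟩ := h x
    obtain ⟨pa, ha, pb, hb, H⟩ := eventually_prod_iff.1 hB
    filter_upwards [ha.prod_mk ((eventually_ge_atTop B).prod_mk hb)] with t ht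
    exact (H ht.1 ht.2.2).trans ht.2.1
  exact h1.curry.exists

/-! ### Continuity of the combined angle away from the diagonal -/

theorem hyperplaneReflection_smul {r : ℝ} (hr : r ≠ 0) (z v : Euc n) :
    hyperplaneReflection (r • z) v = hyperplaneReflection z v := by
  rw [hyperplaneReflection_apply, hyperplaneReflection_apply, real_inner_smul_left, norm_smul,
    smul_smul, mul_pow, Real.norm_eq_abs, sq_abs]
  congr 2
  rcases eq_or_ne z 0 with rfl | hz
  · simp
  · field_simp

theorem angleCos_smul {r : ℝ} (hr : r ≠ 0) (z : Euc n) (a b : Fin m → Euc n) :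
    angleCos (r • z) a b = angleCos z a b := by
  have : reflFrame (r • z) a = reflFrame z a := by
    ext1 i
    exact hyperplaneReflection_smul hr _ _
  rw [angleCos, this, angleCos]

theorem tendsto_angleCos {α : Type*} {l : Filter α} {z : α → Euc n} {a b : α → Fin m → Euc n}
    {z₀ : Euc n} {a₀ b₀ : Fin m → Euc n} (hz₀ : z₀ ≠ 0) (ha₀ : LinearIndependent ℝ a₀)
    (hb₀ : LinearIndependent ℝ b₀) (hz : Tendsto z l (𝓝 z₀))
    (ha : ∀ i, Tendsto (fun x => a x i) l (𝓝 (a₀ i)))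
    (hb : ∀ i, Tendsto (fun x => b x i) l (𝓝 (b₀ i))) :
    Tendsto (fun x => angleCos (z x) (a x) (b x)) l (𝓝 (angleCos z₀ a₀ b₀)) := by
  have hr : ∀ i, Tendsto (fun x => reflFrame (z x) (a x) i) l (𝓝 (reflFrame z₀ a₀ i)) := by
    intro i
    simp only [reflFrame, hyperplaneReflection_apply]
    refine (ha i).sub (Tendsto.smul (tendsto_const_nhds.mul ?_) hz)
    exact (hz.inner (ha i)).div (hz.norm.pow 2) (by positivity)
  refine (tendsto_det_crossGram hr hb).neg.div
    ((tendsto_det_crossGram ha ha).sqrt.mul (tendsto_det_crossGram hb hb).sqrt) ?_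
  have h1 := Real.sqrt_pos.2 (det_crossGram_self_pos ha₀)
  have h2 := Real.sqrt_pos.2 (det_crossGram_self_pos hb₀)
  positivity

section LocalConvergence

variable {M : ClosedOrientedManifold m k} {l : Filter (Emb M n)} {f₀ : Emb M n}

theorem LocallyC2Tendsto.tendsto_apply (h : LocallyC2Tendsto l f₀) (p₀ : M) :
    Tendsto (fun t : M × Emb M n => t.2.toMap t.1) (𝓝 p₀ ×ˢ l) (𝓝 (f₀.toMap p₀)) := by
  obtain ⟨φ, -, hp, r, hr, -, h1, -⟩ := h p₀
  have hd : Tendsto (fun t : M × Emb M n => t.2.toMap t.1 - f₀.toMap t.1) (𝓝 p₀ ×ˢ l) (𝓝 0) := by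
    rw [Metric.tendsto_nhds]
    intro ε hε
    have hev : ∀ᶠ p in 𝓝 p₀, p ∈ φ.source ∧ φ p ∈ Metric.ball (φ p₀) r :=
      (φ.open_source.eventually_mem hp).and ((φ.continuousAt hp).eventually (Metric.ball_mem_nhds _ hr))
    filter_upwards [hev.prod_mk (h1 (ε / 2) (half_pos hε))] with t ht
    have := (ht.2 _ ht.1.2).1
    rw [φ.left_inv ht.1.1] at this
    rw [dist_zero_right]
    linarith
  have hc : Tendsto (fun t : M × Emb M n => f₀.toMap t.1) (𝓝 p₀ ×ˢ l) (𝓝 (f₀.toMap p₀)) :=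
    (f₀.toMap.contMDiff.continuous.tendsto p₀).comp tendsto_fst
  simpa using hd.add hc

theorem tendsto_chartFrame (hk : 2 ≤ k) {φ : OpenPartialHomeomorph M (Euc m)}
    (hφ : φ ∈ atlas (Euc m) M) {p₀ : M} (hp : p₀ ∈ φ.source) {r : ℝ} (hr : 0 < r)
    (h : ∀ ε > 0, ∀ᶠ f in l, ∀ x ∈ Metric.ball (φ p₀) r,
      ‖f.toMap (φ.symm x) - f₀.toMap (φ.symm x)‖ ≤ ε ∧
      ‖fderiv ℝ (f.toMap ∘ φ.symm) x - fderiv ℝ (f₀.toMap ∘ φ.symm) x‖ ≤ ε) (i : Fin m) :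
    Tendsto (fun t : M × Emb M n => chartFrame t.2.toMap φ t.1 i) (𝓝 p₀ ×ˢ l)
      (𝓝 (chartFrame f₀.toMap φ p₀ i)) := by
  have hd : Tendsto (fun t : M × Emb M n => chartFrame t.2.toMap φ t.1 i -
      chartFrame f₀.toMap φ t.1 i) (𝓝 p₀ ×ˢ l) (𝓝 0) := by
    rw [Metric.tendsto_nhds]
    intro ε hε
    have hev : ∀ᶠ p in 𝓝 p₀, φ p ∈ Metric.ball (φ p₀) r :=
      (φ.continuousAt hp) (Metric.ball_mem_nhds _ hr)
    filter_upwards [hev.prod_mk (h (ε / 2) (half_pos hε))] with t ht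
    have h1 := (ht.2 _ ht.1).2
    have h2 := (fderiv ℝ (t.2.toMap ∘ φ.symm) (φ t.1) -
      fderiv ℝ (f₀.toMap ∘ φ.symm) (φ t.1)).le_opNorm (EuclideanSpace.single i 1)
    rw [dist_zero_right]
    simp only [sub_apply, PiLp.norm_single, norm_one, mul_one] at h2
    simp only [chartFrame]
    linarith
  have hc : Tendsto (fun t : M × Emb M n => chartFrame f₀.toMap φ t.1 i) (𝓝 p₀ ×ˢ l)
      (𝓝 (chartFrame f₀.toMap φ p₀ i)) := by
    have h1 : ContinuousAt (fderiv ℝ (f₀.toMap ∘ φ.symm)) (φ p₀) :=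
      ((contDiffAt_comp_chart_symm hk f₀.toMap hφ (φ.map_source hp)).fderiv_right
        (m := 1) (by norm_num)).continuousAt
    have h2 : Tendsto (fun p => fderiv ℝ (f₀.toMap ∘ φ.symm) (φ p)) (𝓝 p₀)
        (𝓝 (fderiv ℝ (f₀.toMap ∘ φ.symm) (φ p₀))) := h1.tendsto.comp (φ.continuousAt hp)
    exact (((ContinuousLinearMap.apply ℝ (Euc n)
      (EuclideanSpace.single i (1 : ℝ) : Euc m)).continuous.tendsto _).comp h2).comp tendsto_fst
  simpa using hd.add hc

/-- The integrand of the energy. -/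
def integrand (f : Emb M n) (t : M × M) : ℝ :=
  (1 - cosCombinedAngle (positiveFrames f.toMap) (f.toMap t.1) (f.toMap t.2)) ^ m /
    dist (f.toMap t.1) (f.toMap t.2) ^ (2 * m)

/-- The denominator is `0 ^ (2 * m) = 0`, and division by zero gives zero whatever the angle is. -/
theorem integrand_self (hm : 1 ≤ m) (f : Emb M n) (p : M) : integrand f (p, p) = 0 := by
  have : 2 * m ≠ 0 := by omega
  simp [integrand, this]

theorem LocallyC2Tendsto.tendsto_integrand (hm : 1 ≤ m) (hk : 2 ≤ k) (h : LocallyC2Tendsto l f₀)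
    {p₀ q₀ : M} (hpq : p₀ ≠ q₀) :
    Tendsto (fun t : (M × M) × Emb M n => integrand t.2 t.1) (𝓝 (p₀, q₀) ×ˢ l)
      (𝓝 (integrand f₀ (p₀, q₀))) := by
  obtain ⟨φ, hφ, hp, r, hr, -, h1, -⟩ := h p₀
  obtain ⟨ψ, hψ, hq, s, hs, -, h2, -⟩ := h q₀
  have hfst : Tendsto (fun t : (M × M) × Emb M n => (t.1.1, t.2)) (𝓝 (p₀, q₀) ×ˢ l)
      (𝓝 p₀ ×ˢ l) :=
    ((continuous_fst.tendsto (p₀, q₀)).comp tendsto_fst).prodMk tendsto_snd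
  have hsnd : Tendsto (fun t : (M × M) × Emb M n => (t.1.2, t.2)) (𝓝 (p₀, q₀) ×ˢ l)
      (𝓝 q₀ ×ˢ l) :=
    ((continuous_snd.tendsto (p₀, q₀)).comp tendsto_fst).prodMk tendsto_snd
  have hfp := (h.tendsto_apply p₀).comp hfst
  have hfq := (h.tendsto_apply q₀).comp hsnd
  have hne : f₀.toMap p₀ ≠ f₀.toMap q₀ := fun h => hpq (f₀.isEmbedding.injective h)
  have hcos := tendsto_angleCos (sub_ne_zero.2 hne.symm)
    (linearIndependent_chartFrame hk f₀ hφ hp) (linearIndependent_chartFrame hk f₀ hψ hq)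
    (hfq.sub hfp) (fun i => (tendsto_chartFrame hk hφ hp hr h1 i).comp hfst)
    (fun i => (tendsto_chartFrame hk hψ hq hs h2 i).comp hsnd)
  have hF := ((tendsto_const_nhds (x := (1 : ℝ))).sub hcos).pow m |>.div
    ((hfp.dist hfq).pow (2 * m)) (pow_ne_zero _ (dist_ne_zero.2 hne))
  rw [← cosCombinedAngle_eq hm hk f₀ hφ hψ hp hq hpq] at hF
  refine hF.congr' ?_
  have hev : ∀ᶠ t in 𝓝 (p₀, q₀), t.1 ∈ φ.source ∧ t.2 ∈ ψ.source ∧ t.1 ≠ t.2 :=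
    ((continuous_fst.tendsto (p₀, q₀)).eventually (φ.open_source.eventually_mem hp)).and
      (((continuous_snd.tendsto (p₀, q₀)).eventually (ψ.open_source.eventually_mem hq)).and
        ((isOpen_ne_fun continuous_fst continuous_snd).eventually_mem hpq))
  filter_upwards [tendsto_fst.eventually hev] with t ht
  simp only [integrand, cosCombinedAngle_eq hm hk t.2 hφ hψ ht.1 ht.2.1 ht.2.2, Function.comp]
  rfl

/-! ### Estimates near the diagonal -/

/-- A strictly differentiable map with injective derivative is bi-Lipschitz near the point. -/
theorem isBigO_chart_sub (hk : 2 ≤ k) (f₀ : Emb M n) {φ : OpenPartialHomeomorph M (Euc m)}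
    (hφ : φ ∈ atlas (Euc m) M) {p₀ : M} (hp : p₀ ∈ φ.source) :
    (fun t : M × M => φ t.1 - φ t.2) =O[𝓝 (p₀, p₀)]
      fun t => f₀.toMap t.1 - f₀.toMap t.2 := by
  have hx := φ.map_source hp
  have hs : HasStrictFDerivAt (f₀.toMap ∘ φ.symm) (fderiv ℝ (f₀.toMap ∘ φ.symm) (φ p₀)) (φ p₀) :=
    (contDiffAt_comp_chart_symm hk f₀.toMap hφ hx).hasStrictFDerivAt (by norm_num)
  obtain ⟨K, -, hK⟩ := LinearMap.exists_antilipschitzWith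
    (fderiv ℝ (f₀.toMap ∘ φ.symm) (φ p₀) : Euc m →ₗ[ℝ] Euc n)
    (LinearMap.ker_eq_bot.2 (injective_fderiv_comp_chart_symm hk f₀ hφ hx))
  have h1 := (hs.isTheta_sub (hK.isInducing (fderiv ℝ (f₀.toMap ∘ φ.symm) (φ p₀)).continuous)).symm.isBigO
  have hc : Tendsto (fun t : M × M => (φ t.1, φ t.2)) (𝓝 (p₀, p₀)) (𝓝 (φ p₀, φ p₀)) := by
    have h2 := φ.continuousAt hp
    exact (h2.comp (x := (p₀, p₀)) continuousAt_fst).prodMk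
      (h2.comp (x := (p₀, p₀)) continuousAt_snd)
  refine (h1.comp_tendsto hc).congr' EventuallyEq.rfl ?_
  have hsrc := φ.open_source.mem_nhds hp
  filter_upwards [prod_mem_nhds hsrc hsrc] with t ht
  simp [φ.left_inv ht.1, φ.left_inv ht.2]

/-- Embeddings that are close in the `C²` topology differ by a map with small Lipschitz constant. -/
theorem LocallyC2Tendsto.eventually_norm_sub_le (hk : 2 ≤ k) (h : LocallyC2Tendsto l f₀)
    {ε : ℝ} (hε : 0 < ε) : ∀ᶠ f in l, ∀ t : M × M,
      ‖(f.toMap t.1 - f₀.toMap t.1) - (f.toMap t.2 - f₀.toMap t.2)‖ ≤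
        ε * ‖f₀.toMap t.1 - f₀.toMap t.2‖ := by
  refine eventually_forall_of_local fun ⟨p₀, q₀⟩ => ?_
  have hfst : Tendsto (fun t : (M × M) × Emb M n => (t.1.1, t.2)) (𝓝 (p₀, q₀) ×ˢ l)
      (𝓝 p₀ ×ˢ l) :=
    ((continuous_fst.tendsto (p₀, q₀)).comp tendsto_fst).prodMk tendsto_snd
  have hsnd : Tendsto (fun t : (M × M) × Emb M n => (t.1.2, t.2)) (𝓝 (p₀, q₀) ×ˢ l)
      (𝓝 q₀ ×ˢ l) :=
    ((continuous_snd.tendsto (p₀, q₀)).comp tendsto_fst).prodMk tendsto_snd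
  rcases eq_or_ne p₀ q₀ with rfl | hpq
  -- On the diagonal, the mean value inequality applies to the difference of the two maps in a
  -- chart; `K` converts coordinate distance to distance of the images under `f₀`.
  · obtain ⟨φ, hφ, hp, r, hr, hb, h1, -⟩ := h p₀
    obtain ⟨K, hK0, hK⟩ := (isBigO_chart_sub hk f₀ hφ hp).exists_pos
    have hev : ∀ᶠ p in 𝓝 p₀, p ∈ φ.source ∧ φ p ∈ Metric.ball (φ p₀) r :=
      (φ.open_source.eventually_mem hp).and ((φ.continuousAt hp).eventually (Metric.ball_mem_nhds _ hr))
    filter_upwards [hfst.eventually (hev.prod_mk (h1 (ε / K) (div_pos hε hK0))),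
      hsnd.eventually (tendsto_fst.eventually hev), tendsto_fst.eventually hK.bound]
      with t ht1 ht2 ht3
    have hdiff : ∀ g : Emb M n, ∀ x ∈ Metric.ball (φ p₀) r,
        DifferentiableAt ℝ (g.toMap ∘ φ.symm) x := fun g x hx =>
      (contDiffAt_comp_chart_symm hk g.toMap hφ (hb hx)).differentiableAt (by norm_num)
    have := (convex_ball (φ p₀) r).norm_image_sub_le_of_norm_fderiv_le (𝕜 := ℝ)
      (f := t.2.toMap ∘ φ.symm - f₀.toMap ∘ φ.symm) (C := ε / K)
      (fun x hx => (hdiff _ x hx).sub (hdiff _ x hx))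
      (fun x hx => by
        rw [fderiv_sub (hdiff _ x hx) (hdiff _ x hx)]
        exact (ht1.2 x hx).2) ht2.2 ht1.1.2
    simp only [Pi.sub_apply, Function.comp, φ.left_inv ht1.1.1, φ.left_inv ht2.1] at this
    refine this.trans ((mul_le_mul_of_nonneg_left ht3 (by positivity)).trans_eq ?_)
    field_simp
  -- Off the diagonal, the left side tends to `0` and the right side to a positive number.
  · have hne : f₀.toMap p₀ ≠ f₀.toMap q₀ := fun h => hpq (f₀.isEmbedding.injective h)
    have hc0 : ∀ p : M, Tendsto (fun t : M × Emb M n => f₀.toMap t.1) (𝓝 p ×ˢ l)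
        (𝓝 (f₀.toMap p)) := fun p =>
      (f₀.toMap.contMDiff.continuous.tendsto p).comp tendsto_fst
    have hL := ((((h.tendsto_apply p₀).sub (hc0 p₀)).comp hfst).sub
      (((h.tendsto_apply q₀).sub (hc0 q₀)).comp hsnd)).norm
    have hR := (((hc0 p₀).comp hfst).sub ((hc0 q₀).comp hsnd)).norm.const_mul ε
    simp only [sub_self, norm_zero] at hL
    have hpos : 0 < ε * ‖f₀.toMap p₀ - f₀.toMap q₀‖ :=
      mul_pos hε (norm_pos_iff.2 (sub_ne_zero.2 hne))
    exact (hL.eventually_lt hR hpos).mono fun t ht => ht.le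

/-- This is `one_sub_angleCos_isBigO` with `δ` the coordinate distance. Points and embedding vary
together along the product filter, which makes the constant uniform in the embedding. The diagonal
is removed because the formula for the angle needs distinct points. -/
theorem LocallyC2Tendsto.isBigO_one_sub_cosCombinedAngle (hm : 1 ≤ m) (hk : 2 ≤ k)
    (h : LocallyC2Tendsto l f₀) (p₀ : M) :
    (fun t : (M × M) × Emb M n =>
      1 - cosCombinedAngle (positiveFrames t.2.toMap) (t.2.toMap t.1.1) (t.2.toMap t.1.2))
      =O[(𝓝 (p₀, p₀) ×ˢ l) ⊓ 𝓟 {t | t.1.1 ≠ t.1.2}]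
      fun t => dist (t.2.toMap t.1.1) (t.2.toMap t.1.2) ^ 2 := by
  obtain ⟨φ, hφ, hp, r, hr, hb, h1, C, hC⟩ := h p₀
  have hx := φ.map_source hp
  set L := (𝓝 (p₀, p₀) ×ˢ l) ⊓ 𝓟 {t : (M × M) × Emb M n | t.1.1 ≠ t.1.2} with hL
  have hLle : L ≤ 𝓝 (p₀, p₀) ×ˢ l := inf_le_left
  have hne : ∀ᶠ t in L, t.1.1 ≠ t.1.2 := mem_inf_of_right (mem_principal_self _)
  have hfst : Tendsto (fun t : (M × M) × Emb M n => (t.1.1, t.2)) L (𝓝 p₀ ×ˢ l) :=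
    (((continuous_fst.tendsto (p₀, p₀)).comp tendsto_fst).prodMk tendsto_snd).mono_left hLle
  have hsnd : Tendsto (fun t : (M × M) × Emb M n => (t.1.2, t.2)) L (𝓝 p₀ ×ˢ l) :=
    (((continuous_snd.tendsto (p₀, p₀)).comp tendsto_fst).prodMk tendsto_snd).mono_left hLle
  have hev : ∀ᶠ p in 𝓝 p₀, p ∈ φ.source ∧ φ p ∈ Metric.ball (φ p₀) r :=
    (φ.open_source.eventually_mem hp).and ((φ.continuousAt hp).eventually (Metric.ball_mem_nhds _ hr))
  have hev1 := hfst.eventually (tendsto_fst.eventually hev)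
  have hev2 := hsnd.eventually (tendsto_fst.eventually hev)
  have hevC := hfst.eventually (tendsto_snd.eventually hC)
  -- the distance of the coordinates is controlled by the distance of the images
  have hδv : (fun t : (M × M) × Emb M n => φ t.1.2 - φ t.1.1) =O[L]
      fun t => t.2.toMap t.1.2 - t.2.toMap t.1.1 := by
    have hO : (fun t : (M × M) × Emb M n => φ t.1.1 - φ t.1.2) =O[L]
        fun t => f₀.toMap t.1.1 - f₀.toMap t.1.2 :=
      ((isBigO_chart_sub hk f₀ hφ hp).comp_tendsto tendsto_fst).mono hLle
    have hO2 : (fun t : (M × M) × Emb M n => f₀.toMap t.1.1 - f₀.toMap t.1.2) =O[L]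
        fun t => t.2.toMap t.1.1 - t.2.toMap t.1.2 := by
      -- If `f - f₀` has Lipschitz constant at most `1 / 2` relative to `f₀`, differences of `f₀`
      -- are at most twice those of `f`.
      refine IsBigO.of_bound 2 ?_
      have := h.eventually_norm_sub_le hk (ε := 1 / 2) (by norm_num)
      filter_upwards [hfst.eventually (tendsto_snd.eventually this)] with t ht
      have h2 := ht t.1
      have h3 : f₀.toMap t.1.1 - f₀.toMap t.1.2 = (t.2.toMap t.1.1 - t.2.toMap t.1.2) -
        ((t.2.toMap t.1.1 - f₀.toMap t.1.1) - (t.2.toMap t.1.2 - f₀.toMap t.1.2)) := by abel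
      have h4 := norm_sub_le (t.2.toMap t.1.1 - t.2.toMap t.1.2)
        ((t.2.toMap t.1.1 - f₀.toMap t.1.1) - (t.2.toMap t.1.2 - f₀.toMap t.1.2))
      rw [← h3] at h4
      linarith
    refine IsBigO.of_norm_norm (((hO.trans hO2).norm_norm).congr (fun t => ?_) fun t => ?_)
    · exact norm_sub_rev _ _
    · exact norm_sub_rev _ _
  have hvne : ∀ᶠ t in L, t.2.toMap t.1.2 - t.2.toMap t.1.1 ≠ 0 := hne.mono fun t ht =>
    sub_ne_zero.2 fun h => ht (t.2.isEmbedding.injective h).symm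
  have hquot : (fun t : (M × M) × Emb M n => ‖t.2.toMap t.1.2 - t.2.toMap t.1.1‖⁻¹ *
      ‖φ t.1.2 - φ t.1.1‖) =O[L] fun _ => (1 : ℝ) := by
    refine ((isBigO_refl (fun t : (M × M) × Emb M n =>
      ‖t.2.toMap t.1.2 - t.2.toMap t.1.1‖⁻¹) L).mul hδv.norm_norm).congr' EventuallyEq.rfl ?_
    filter_upwards [hvne] with t ht
    exact inv_mul_cancel₀ (norm_ne_zero_iff.2 ht)
  have htaylor : (fun t : (M × M) × Emb M n => t.2.toMap t.1.2 - t.2.toMap t.1.1 -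
      fderiv ℝ (t.2.toMap ∘ φ.symm) (φ t.1.1) (φ t.1.2 - φ t.1.1)) =O[L]
      fun t => ‖φ t.1.2 - φ t.1.1‖ * ‖φ t.1.2 - φ t.1.1‖ := by
    refine IsBigO.of_bound |C| ?_
    filter_upwards [hev1, hev2, hevC] with t ht1 ht2 ht3
    -- On this convex set the derivative stays within `|C| ‖φ t.1.2 - φ t.1.1‖` of its value at the
    -- base point, which makes the Taylor remainder quadratic.
    set S := Metric.ball (φ p₀) r ∩ Metric.closedBall (φ t.1.1) ‖φ t.1.2 - φ t.1.1‖ with hS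
    have hconv : Convex ℝ S := (convex_ball _ _).inter (convex_closedBall _ _)
    have := hconv.norm_image_sub_le_of_norm_fderiv_le' (𝕜 := ℝ) (f := t.2.toMap ∘ φ.symm)
      (φ := fderiv ℝ (t.2.toMap ∘ φ.symm) (φ t.1.1)) (C := |C| * ‖φ t.1.2 - φ t.1.1‖)
      (x := φ t.1.1) (y := φ t.1.2)
      (fun x hx => (contDiffAt_comp_chart_symm hk t.2.toMap hφ (hb hx.1)).differentiableAt
        (by norm_num))
      (fun x hx => by
        refine (ht3 x hx.1 _ ht1.2).trans ?_
        have hxn : ‖x - φ t.1.1‖ ≤ ‖φ t.1.2 - φ t.1.1‖ := by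
          rw [← dist_eq_norm]
          exact hx.2
        exact mul_le_mul (le_abs_self _) hxn (norm_nonneg _) (abs_nonneg _))
      ⟨ht1.2, Metric.mem_closedBall_self (norm_nonneg _)⟩
      ⟨ht2.2, by rw [Metric.mem_closedBall, dist_eq_norm]⟩
    simp only [Function.comp, φ.left_inv ht1.1, φ.left_inv ht2.1] at this
    rw [norm_mul, norm_norm, ← mul_assoc]
    exact this
  -- The direction is normalized to a unit vector, which does not change `angleCos`; its approximate
  -- coordinates `t` in the frame at the first point come from the first-order Taylor expansion.
  have hmain := one_sub_angleCos_isBigO (l := L)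
    (a := fun t => chartFrame t.2.toMap φ t.1.1) (b := fun t => chartFrame t.2.toMap φ t.1.2)
    (a₀ := chartFrame f₀.toMap φ p₀)
    (z := fun t => ‖t.2.toMap t.1.2 - t.2.toMap t.1.1‖⁻¹ • (t.2.toMap t.1.2 - t.2.toMap t.1.1))
    (t := fun t i => ‖t.2.toMap t.1.2 - t.2.toMap t.1.1‖⁻¹ * (φ t.1.2 - φ t.1.1) i)
    (δ := fun t => ‖φ t.1.2 - φ t.1.1‖)
    (linearIndependent_chartFrame hk f₀ hφ hp) ?_
    (fun i => (tendsto_chartFrame hk hφ hp hr h1 i).comp hfst) (fun i => ?_) ?_ (fun i => ?_) ?_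
  · have hfin : (fun t : (M × M) × Emb M n => ‖φ t.1.2 - φ t.1.1‖ ^ 2) =O[L]
        fun t => dist (t.2.toMap t.1.1) (t.2.toMap t.1.2) ^ 2 := by
      refine (hδv.norm_norm.pow 2).congr_right fun t => ?_
      rw [dist_comm, dist_eq_norm]
    refine (hmain.trans hfin).congr' ?_ EventuallyEq.rfl
    filter_upwards [hev1, hev2, hne, hvne] with t ht1 ht2 ht3 ht4
    rw [angleCos_smul (inv_ne_zero (norm_ne_zero_iff.2 ht4)),
      cosCombinedAngle_eq hm hk t.2 hφ hφ ht1.1 ht2.1 ht3]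
  · have hc := φ.continuousAt hp
    have h2 := ((hc.tendsto.comp tendsto_fst).comp hsnd).sub
      ((hc.tendsto.comp tendsto_fst).comp hfst)
    rw [sub_self] at h2
    simpa [Function.comp_def] using h2.norm
  · refine IsBigO.of_bound |C| ?_
    filter_upwards [hev1, hev2, hevC] with t ht1 ht2 ht3
    have h2 := (fderiv ℝ (t.2.toMap ∘ φ.symm) (φ t.1.2) -
      fderiv ℝ (t.2.toMap ∘ φ.symm) (φ t.1.1)).le_opNorm (EuclideanSpace.single i 1)
    simp only [sub_apply, PiLp.norm_single, norm_one, mul_one] at h2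
    rw [norm_norm]
    refine h2.trans ((ht3 _ ht2.2 _ ht1.2).trans ?_)
    exact mul_le_mul_of_nonneg_right (le_abs_self _) (norm_nonneg _)
  · filter_upwards [hvne] with t ht
    rw [norm_smul, norm_inv, norm_norm, inv_mul_cancel₀ (norm_ne_zero_iff.2 ht)]
  · refine IsBigO.trans (IsBigO.of_bound 1 (Eventually.of_forall fun t => ?_)) hquot
    rw [one_mul, norm_mul, norm_mul, norm_norm]
    exact mul_le_mul_of_nonneg_left (PiLp.norm_apply_le _ i) (norm_nonneg _)
  · have h2 := (isBigO_refl (fun t : (M × M) × Emb M n =>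
      ‖t.2.toMap t.1.2 - t.2.toMap t.1.1‖⁻¹) L).smul htaylor
    have h3 := hquot.mul (isBigO_refl (fun t : (M × M) × Emb M n => ‖φ t.1.2 - φ t.1.1‖) L)
    simp only [one_mul] at h3
    refine (h2.trans (h3.congr_left fun t => ?_)).congr_left fun t => ?_
    · rw [smul_eq_mul, mul_assoc]
    · rw [smul_sub]
      congr 1
      conv_lhs => rw [← sum_smul_single (φ t.1.2 - φ t.1.1), map_sum]
      simp [chartFrame, Finset.smul_sum, smul_smul]

theorem LocallyC2Tendsto.exists_integrand_le (hm : 1 ≤ m) (hk : 2 ≤ k)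
    (h : LocallyC2Tendsto l f₀) : ∃ B : ℝ, ∀ᶠ f in l, ∀ t : M × M, integrand f t ≤ B := by
  refine exists_bound_of_local (F := fun t (f : Emb M n) => integrand f t) fun ⟨p₀, q₀⟩ => ?_
  rcases eq_or_ne p₀ q₀ with rfl | hpq
  · obtain ⟨B, hB0, hB⟩ := (h.isBigO_one_sub_cosCombinedAngle hm hk p₀).exists_pos
    refine ⟨B ^ m, ?_⟩
    filter_upwards [eventually_inf_principal.1 hB.bound] with ⟨⟨p, q⟩, f⟩ ht
    rcases eq_or_ne p q with rfl | hpq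
    · rw [integrand_self hm]
      positivity
    · have hd : 0 < dist (f.toMap p) (f.toMap q) :=
        dist_pos.2 fun h => hpq (f.isEmbedding.injective h)
      have h1 := ht hpq
      rw [Real.norm_eq_abs, Real.norm_of_nonneg (by positivity)] at h1
      -- The exponents match: the `m`-th power of the quadratic bound cancels the denominator.
      rw [integrand, div_le_iff₀ (by positivity), pow_mul, ← mul_pow]
      refine (le_abs_self _).trans ?_
      rw [abs_pow]
      exact pow_le_pow_left₀ (abs_nonneg _) h1 m
  · exact ⟨integrand f₀ (p₀, q₀) + 1,
      ((h.tendsto_integrand hm hk hpq).eventually (gt_mem_nhds (lt_add_one _))).mono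
        fun t ht => ht.le⟩

end LocalConvergence

/-! ### The volume of embedded submanifolds -/

/-- The hypothesis makes `f` factor through `g` on `s` by a `K`-Lipschitz map. Injectivity of `g` is
not needed, since `g x = g y` forces `f x = f y`. -/
theorem euclideanHausdorffMeasure_image_le {X Y Z : Type*} [EMetricSpace X] [MeasurableSpace X]
    [BorelSpace X] [EMetricSpace Y] [MeasurableSpace Y] [BorelSpace Y] {f : Z → Y} {g : Z → X}
    {s : Set Z} {K : ℝ≥0} (h : ∀ x ∈ s, ∀ y ∈ s, edist (f x) (f y) ≤ K * edist (g x) (g y))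
    (d : ℕ) : μHE[d] (f '' s) ≤ (K : ℝ≥0∞) ^ d * μHE[d] (g '' s) := by
  rcases s.eq_empty_or_nonempty with rfl | ⟨x₀, -⟩
  · simp
  have : Nonempty Z := ⟨x₀⟩
  have hinv : ∀ x ∈ s, Function.invFunOn g s (g x) ∈ s ∧ g (Function.invFunOn g s (g x)) = g x :=
    fun x hx => ⟨Function.invFunOn_mem ⟨x, hx, rfl⟩, Function.invFunOn_eq ⟨x, hx, rfl⟩⟩
  have hlip : LipschitzOnWith K (f ∘ Function.invFunOn g s) (g '' s) := by
    rintro _ ⟨x, hx, rfl⟩ _ ⟨y, hy, rfl⟩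
    have := h _ (hinv x hx).1 _ (hinv y hy).1
    rwa [(hinv x hx).2, (hinv y hy).2] at this
  have himg : (f ∘ Function.invFunOn g s) '' (g '' s) = f '' s := by
    rw [image_image]
    refine image_congr fun x hx => ?_
    have := h _ (hinv x hx).1 _ hx
    rw [(hinv x hx).2, edist_self, mul_zero, nonpos_iff_eq_zero, edist_eq_zero] at this
    exact this
  have h1 := hlip.hausdorffMeasure_image_le (d := d) (Nat.cast_nonneg d)
  rw [himg, ENNReal.rpow_natCast] at h1
  rw [Measure.euclideanHausdorffMeasure_def, Measure.euclideanHausdorffMeasure_def,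
    Measure.smul_apply, Measure.smul_apply, mul_smul_comm]
  exact smul_le_smul_of_nonneg_left h1 zero_le

/-- Locally the image is a Lipschitz image of a subset of a coordinate ball, and finitely many such
pieces suffice. -/
theorem euclideanHausdorffMeasure_range_lt_top (hk : 2 ≤ k) {M : ClosedOrientedManifold m k}
    (f : Emb M n) : μHE[m] (range f.toMap) < ⊤ := by
  rw [← image_univ]
  refine isCompact_univ.induction_on (p := fun s => μHE[m] (f.toMap '' s) < ⊤) (by simp)
    (fun s t hst ht => (measure_mono (image_mono hst)).trans_lt ht)
    (fun s t hs ht => by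
      rw [image_union]
      exact (measure_union_le _ _).trans_lt (ENNReal.add_lt_top.2 ⟨hs, ht⟩)) fun p _ => ?_
  have hp := mem_chart_source (Euc m) p
  obtain ⟨K, t, ht, hK⟩ := ((contDiffAt_comp_chart_symm hk f.toMap (chart_mem_atlas (Euc m) p)
    ((chartAt (Euc m) p).map_source hp)).of_le (m := 1) (by norm_num)).exists_lipschitzOnWith
  rw [nhdsWithin_univ]
  refine ⟨(chartAt (Euc m) p).source ∩ chartAt (Euc m) p ⁻¹'
    (t ∩ Metric.ball (chartAt (Euc m) p p) 1), Filter.inter_mem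
    ((chartAt (Euc m) p).open_source.mem_nhds hp)
    (((chartAt (Euc m) p).continuousAt hp).preimage_mem_nhds
      (Filter.inter_mem ht (Metric.ball_mem_nhds _ one_pos))), ?_⟩
  refine (euclideanHausdorffMeasure_image_le (g := chartAt (Euc m) p) (K := K)
    (fun x hx y hy => ?_) m).trans_lt ?_
  · have := hK hx.2.1 hy.2.1
    simpa only [Function.comp, (chartAt (Euc m) p).left_inv hx.1,
      (chartAt (Euc m) p).left_inv hy.1] using this
  · have hH : (μHE[m] : Measure (Euc m)).IsAddHaarMeasure := by
      have := isAddHaarMeasure_euclideanHausdorffMeasure (E := Euc m)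
      rwa [finrank_euclideanSpace_fin] at this
    refine ENNReal.mul_lt_top (ENNReal.pow_lt_top ENNReal.coe_lt_top)
      ((measure_mono ?_).trans_lt (measure_ball_lt_top (x := chartAt (Euc m) p p) (r := 1)))
    rintro _ ⟨x, hx, rfl⟩
    exact hx.2.2

instance (M : ClosedOrientedManifold m k) : MeasurableSpace M := borel M

instance (M : ClosedOrientedManifold m k) : BorelSpace M := ⟨rfl⟩

instance (M : ClosedOrientedManifold m k) : SecondCountableTopology M :=
  ChartedSpace.secondCountable_of_sigmaCompact (Euc m) M

section Energy

variable {M : ClosedOrientedManifold m k}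

theorem Emb.measurableEmbedding (f : Emb M n) : MeasurableEmbedding f.toMap :=
  (f.toMap.contMDiff.continuous.isClosedEmbedding f.isEmbedding.injective).measurableEmbedding

/-- The volume of an embedded submanifold, as a measure on its parameter space. -/
def Emb.volume (f : Emb M n) : Measure M := Measure.comap f.toMap μHE[m]

theorem Emb.isFiniteMeasure_volume (hk : 2 ≤ k) (f : Emb M n) : IsFiniteMeasure f.volume := by
  refine ⟨?_⟩
  rw [Emb.volume, f.measurableEmbedding.comap_apply, image_univ]
  exact euclideanHausdorffMeasure_range_lt_top hk f

theorem Emb.volume_le {f g : Emb M n} {K : ℝ≥0}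
    (h : ∀ t : M × M, ‖f.toMap t.1 - f.toMap t.2‖ ≤ K * ‖g.toMap t.1 - g.toMap t.2‖) :
    f.volume ≤ (K : ℝ≥0∞) ^ m • g.volume := by
  refine Measure.le_iff.2 fun s _ => ?_
  rw [Measure.smul_apply, Emb.volume, Emb.volume, f.measurableEmbedding.comap_apply,
    g.measurableEmbedding.comap_apply]
  refine euclideanHausdorffMeasure_image_le (fun x _ y _ => ?_) m
  rw [edist_nndist, edist_nndist, ← ENNReal.coe_mul, ENNReal.coe_le_coe, ← NNReal.coe_le_coe,
    NNReal.coe_mul, coe_nndist, coe_nndist, dist_eq_norm, dist_eq_norm]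
  exact h (x, y)

/-! ### The energy as a double integral over the parameter manifold. -/

/-- The integral of the integrand of the energy of `f` with respect to a measure on the parameter
space. -/
def energyWith (f : Emb M n) (μ : Measure M) : ℝ≥0∞ :=
  ∫⁻ p, ∫⁻ q, ENNReal.ofReal (integrand f (p, q)) ∂μ ∂μ

theorem energyOfMap_eq_energyWith (f : Emb M n) :
    energyOfMap f.toMap = energyWith f f.volume := by
  have hr : (μHE[m] : Measure (Euc n)).restrict (range f.toMap) = f.volume.map f.toMap :=
    (f.measurableEmbedding.map_comap _).symm
  rw [energyOfMap, hr, f.measurableEmbedding.lintegral_map]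
  simp_rw [f.measurableEmbedding.lintegral_map]
  rfl

theorem energyWith_le {f : Emb M n} {μ ν : Measure M} {c : ℝ≥0∞} (h : μ ≤ c • ν) (hc : c ≠ ⊤) :
    energyWith f μ ≤ c * c * energyWith f ν := by
  refine (lintegral_mono' h fun p => lintegral_mono' h le_rfl).trans_eq ?_
  simp_rw [lintegral_smul_measure, smul_eq_mul]
  rw [lintegral_const_mul' _ _ hc, ← mul_assoc]
  rfl

/-- The integrand is continuous on the open complement of the diagonal and zero on the diagonal.
Continuity is the convergence statement for the constant filter `pure f`. -/
theorem measurable_integrand (hm : 1 ≤ m) (hk : 2 ≤ k) (f : Emb M n) :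
    Measurable (integrand f) := by
  classical
  obtain ⟨l, -, hl, h⟩ := exists_locallyC2Tendsto hk f
  let := embTopology 2 M n
  have hf : LocallyC2Tendsto (pure f) f := h.mono ((pure_le_nhds f).trans hl)
  have hcont : ContinuousOn (integrand f) {t | t.1 ≠ t.2} := by
    rintro ⟨p, q⟩ hpq
    have h1 := hf.tendsto_integrand hm hk hpq
    rw [prod_pure, tendsto_map'_iff] at h1
    exact ContinuousAt.continuousWithinAt h1
  have heq : integrand f = {t : M × M | t.1 ≠ t.2}.piecewise (integrand f) fun _ => 0 := by
    ext1 ⟨p, q⟩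
    by_cases hpq : p = q
    · subst hpq
      rw [piecewise_eq_of_notMem _ _ _ (by simp), integrand_self hm]
    · rw [piecewise_eq_of_mem _ _ _ hpq]
  rw [heq]
  exact hcont.measurable_piecewise continuousOn_const
    (isOpen_ne_fun continuous_fst continuous_snd).measurableSet

theorem energyWith_eq_lintegral_prod (hm : 1 ≤ m) (hk : 2 ≤ k) (f : Emb M n) (μ : Measure M)
    [SFinite μ] : energyWith f μ = ∫⁻ t, ENNReal.ofReal (integrand f t) ∂μ.prod μ := by
  rw [lintegral_prod _ (measurable_integrand hm hk f).ennreal_ofReal.aemeasurable, energyWith]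

variable {l : Filter (Emb M n)} {f₀ : Emb M n}

theorem LocallyC2Tendsto.tendsto_energyWith (hm : 1 ≤ m) (hk : 2 ≤ k)
    [l.IsCountablyGenerated] (h : LocallyC2Tendsto l f₀) (μ : Measure M) [IsFiniteMeasure μ] :
    Tendsto (fun f => energyWith f μ) l (𝓝 (energyWith f₀ μ)) := by
  simp_rw [energyWith_eq_lintegral_prod hm hk]
  obtain ⟨B, hB⟩ := h.exists_integrand_le hm hk
  refine tendsto_lintegral_filter_of_dominated_convergence (fun _ => ENNReal.ofReal B)
    (Eventually.of_forall fun f => (measurable_integrand hm hk f).ennreal_ofReal)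
    (hB.mono fun f hf => Eventually.of_forall fun t => ENNReal.ofReal_le_ofReal (hf t)) ?_
    (Eventually.of_forall fun ⟨p, q⟩ => ?_)
  · rw [lintegral_const]
    exact ENNReal.mul_ne_top ENNReal.ofReal_ne_top (measure_ne_top _ _)
  · refine ENNReal.tendsto_ofReal ?_
    rcases eq_or_ne p q with rfl | hpq
    · simp_rw [integrand_self hm]
      exact tendsto_const_nhds
    · have ht : Tendsto (fun f : Emb M n => ((p, q), f)) l (𝓝 (p, q) ×ˢ l) :=
        tendsto_const_nhds.prodMk tendsto_id
      have h2 := (h.tendsto_integrand hm hk hpq).comp ht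
      simp only [Function.comp_def] at h2
      exact h2

theorem LocallyC2Tendsto.eventually_volume_le (hk : 2 ≤ k) (h : LocallyC2Tendsto l f₀)
    {K : ℝ≥0} (hK : 1 < K) : ∀ᶠ f in l, f.volume ≤ (K : ℝ≥0∞) ^ m • f₀.volume ∧
      f₀.volume ≤ (K : ℝ≥0∞) ^ m • f.volume := by
  have hK' : (1 : ℝ) < K := by exact_mod_cast hK
  have hK0 : (0 : ℝ) < K := one_pos.trans hK'
  -- This `ε` satisfies `1 - ε = 1 / K` and `1 + ε ≤ K`, so it serves both inequalities.
  have hε : (0 : ℝ) < ((K : ℝ) - 1) / K := div_pos (sub_pos.2 hK') hK0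
  filter_upwards [h.eventually_norm_sub_le hk hε] with f hf
  have key : ∀ t : M × M, ‖(f.toMap t.1 - f.toMap t.2) - (f₀.toMap t.1 - f₀.toMap t.2)‖ * K ≤
      (K - 1) * ‖f₀.toMap t.1 - f₀.toMap t.2‖ := fun t => by
    have := hf t
    rw [div_mul_eq_mul_div, le_div_iff₀ hK0, sub_sub_sub_comm] at this
    exact this
  refine ⟨Emb.volume_le fun t => ?_, Emb.volume_le fun t => ?_⟩
  · have h1 := key t
    have h2 := norm_sub_norm_le (f.toMap t.1 - f.toMap t.2) (f₀.toMap t.1 - f₀.toMap t.2)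
    have h3 := norm_nonneg ((f.toMap t.1 - f.toMap t.2) - (f₀.toMap t.1 - f₀.toMap t.2))
    nlinarith
  · have h1 := key t
    have h2 := norm_sub_norm_le (f₀.toMap t.1 - f₀.toMap t.2) (f.toMap t.1 - f.toMap t.2)
    rw [norm_sub_rev (f₀.toMap t.1 - f₀.toMap t.2)] at h2
    nlinarith

theorem energyOfMap_lt_top (hm : 1 ≤ m) (hk : 2 ≤ k) (f : Emb M n) :
    energyOfMap f.toMap < ⊤ := by
  obtain ⟨l, -, hl, h⟩ := exists_locallyC2Tendsto hk f
  let := embTopology 2 M n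
  have := f.isFiniteMeasure_volume hk
  obtain ⟨B, hB⟩ := (h.mono ((pure_le_nhds f).trans hl)).exists_integrand_le hm hk
  rw [eventually_pure] at hB
  rw [energyOfMap_eq_energyWith, energyWith_eq_lintegral_prod hm hk]
  refine (lintegral_mono fun t => ENNReal.ofReal_le_ofReal (hB t)).trans_lt ?_
  rw [lintegral_const]
  exact ENNReal.mul_lt_top ENNReal.ofReal_lt_top (measure_lt_top _ _)

theorem LocallyC2Tendsto.tendsto_energyOfMap (hm : 1 ≤ m) (hk : 2 ≤ k)
    [l.IsCountablyGenerated] (h : LocallyC2Tendsto l f₀) :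
    Tendsto (fun f : Emb M n => energyOfMap f.toMap) l (𝓝 (energyOfMap f₀.toMap)) := by
  have hfin := f₀.isFiniteMeasure_volume hk
  have hlim := h.tendsto_energyWith hm hk f₀.volume
  have hE0 := energyOfMap_lt_top hm hk f₀
  simp_rw [energyOfMap_eq_energyWith] at hE0 ⊢
  have hc : ∀ x : ℝ≥0∞, x ≠ ⊤ → Tendsto (fun K : ℝ≥0 => (K : ℝ≥0∞) ^ m * (K : ℝ≥0∞) ^ m * x)
      (𝓝[>] 1) (𝓝 x) := by
    intro x hx
    have h1 : Continuous fun K : ℝ≥0 => (K : ℝ≥0∞) ^ m * (K : ℝ≥0∞) ^ m * x := by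
      simp_rw [← ENNReal.coe_pow, ← ENNReal.coe_mul]
      exact ENNReal.continuous_mul_const hx |>.comp (by fun_prop)
    simpa using (h1.tendsto 1).mono_left nhdsWithin_le_nhds
  have hK1 : ∀ᶠ K : ℝ≥0 in 𝓝[>] 1, 1 < K := self_mem_nhdsWithin
  have htop : ∀ K : ℝ≥0, (K : ℝ≥0∞) ^ m ≠ ⊤ := fun K => ENNReal.pow_ne_top ENNReal.coe_ne_top
  refine tendsto_order.2 ⟨fun a ha => ?_, fun a ha => ?_⟩
  -- Choose `K > 1` with `K ^ (2m) a` still below the limit energy; replacing the volume of `f₀` by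
  -- that of `f` then loses at most this factor.
  · obtain ⟨K, hKa, hK⟩ := (((hc a (ha.trans hE0).ne).eventually (gt_mem_nhds ha)).and hK1).exists
    filter_upwards [h.eventually_volume_le hk hK, hlim.eventually (lt_mem_nhds hKa)] with f h1 h2
    exact lt_of_mul_lt_mul_left' (h2.trans_le (energyWith_le h1.2 (htop K)))
  -- Choose `K > 1` such that `K ^ (2m)` times the limit energy, which is finite, is still below
  -- `a`.
  · obtain ⟨K, hKa, hK⟩ := (((hc _ hE0.ne).eventually (gt_mem_nhds ha)).and hK1).exists
    have h3 := ENNReal.Tendsto.const_mul hlim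
      (Or.inr (ENNReal.mul_ne_top (htop K) (htop K)))
    filter_upwards [h.eventually_volume_le hk hK, h3.eventually (gt_mem_nhds hKa)] with f h1 h2
    exact (energyWith_le h1.1 (htop K)).trans_lt h2

end Energy

end KusnerSullivan

end

theorem mainTheorem3 (m n : ℕ) (hm : 1 ≤ m) (k : ℕ∞) (hk : 2 ≤ k) :
    (∀ S : KusnerSullivan.EmbeddedSubmanifold m n k, KusnerSullivan.energyKS hk S < ⊤) ∧
      @Continuous (KusnerSullivan.EmbeddedSubmanifold m n k) ℝ≥0∞
        (KusnerSullivan.submanifoldTopology m n k 2) ENNReal.instTopologicalSpace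
        (KusnerSullivan.energyKS hk) := by
  refine ⟨fun S => Quot.inductionOn S fun a => KusnerSullivan.energyOfMap_lt_top hm hk a.2, ?_⟩
  let (M : KusnerSullivan.ClosedOrientedManifold m k) : TopologicalSpace (KusnerSullivan.Emb M n) :=
    KusnerSullivan.embTopology 2 M n
  -- By the universal properties of the quotient and of the disjoint union, continuity is tested at
  -- each embedding of a fixed manifold, where the countably generated filter is coarser than the
  -- neighbourhood filter.
  refine continuous_coinduced_dom.2 (continuous_sigma fun M => continuous_iff_continuousAt.2
    fun f => ?_)
  obtain ⟨l, _, hl, h⟩ := KusnerSullivan.exists_locallyC2Tendsto hk f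
  exact (h.tendsto_energyOfMap hm hk).mono_left hl
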